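/- A ribbon graph $G$ is a (finite) surface with boundary written as the union of vertex-discs $V(G)$ and edge-ribbons $E(G)$ that meet in disjoint line segments, each lying on the boundary of exactly one vertex-disc and one edge-ribbon, every edge-ribbon containing exactly two of them (its ends, or half-edges). Loops, parallel edges and non-orientable surfaces are allowed. Let $F(G)$ be the set of boundary components and $c(G)$ the number of connected components of $G$; the Euler genus is $\varepsilon(G)=2c(G)-(|V(G)|-|E(G)|+|F(G)|)$. For $A\subseteq E(G)$ the partial Petrial $G^{\times|A}$ is obtained by detaching one end of each edge-ribbon in $A$, giving the ribbon a half-twist and reattaching the end. The partial Petrial polynomial is ${}^{\partial}\varepsilon^{\times}_{G}(z)=\sum_{A\subseteq E(G)}z^{\varepsilon(G^{\times|A})}$. If $e$ is an edge-ribbon joining two distinct vertex-discs $u,v$, then the contraction $G/e$ replaces $e,u,v$ by the single vertex-disc $e\cup u\cup v$. For a spanning tree $T$ of a connected ribbon graph $G$, $\mathrm{Aux}(G,T)$ is obtained from $G$ by contracting, one after the other in any order, all edge-ribbons of $T$. A bouquet is a ribbon graph with exactly one vertex-disc; its intersection graph $I(B)$ has vertex set $E(B)$, two distinct edges being adjacent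 when their half-edges alternate in the cyclic order around the vertex-disc. **Theorem.** Let $G$ be a connected ribbon graph with $n\ge 2$ vertices and let $T$ be any spanning tree of $G$. For $X\subseteq E(T)$ let $G_X=G^{\times|X}$. Then $E(T)$ has $2^{n-1}$ subsets $X$, each $\mathrm{Aux}(G_X,T)$ is a bouquet with edge set $E(G)\setminus E(T)$, and $$ {}^{\partial}\varepsilon^{\times}_{G}(z)=\sum_{X\subseteq E(T)}{}^{\partial}\varepsilon^{\times}_{\mathrm{Aux}(G_X,T)}(z)=\sum_{X\subseteq E(T)}\ \sum_{Y\subseteq E(G)\setminus E(T)} z^{\operatorname{rank}\left(\operatorname{adj}(I(\mathrm{Aux}(G_X,T)))+\mathbb D_Y\right)}, $$ where the rank is taken over $\mathrm{GF}(2)$, the matrices have rows and columns indexed by $E(G)\setminus E(T)$, and $\mathbb D_Y$ is the diagonal matrix whose $(i,i)$ entry is $1$ if $i\in Y$ and $0$ otherwise. -/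

import Mathlib

/-- The four corners of an edge-ribbon `e`, viewed as the square `[0,1] × [0,1]`: the corner
`(e, i, s)` lies on the end `{i} × [0,1]` (a line segment along which the ribbon meets a
vertex-disc; the pair `(e, i)` is a half-edge) and on the free side `[0,1] × {s}`. -/
abbrev Corner (α : Type*) := α × Bool × Bool

namespace Corner

/-- The other corner of the same end (half-edge). -/
def acrossEnd {α : Type*} (x : Corner α) : Corner α := (x.1, x.2.1, !x.2.2)

/-- The other corner of the same free side. -/
def alongSide {α : Type*} (x : Corner α) : Corner α := (x.1, !x.2.1, x.2.2)

/-- Exchange the two corners of the end `true` of every ribbon in `A`. -/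
def swapOn {α : Type*} [DecidableEq α] (A : Finset α) (x : Corner α) : Corner α :=
  if x.1 ∈ A ∧ x.2.1 = true then x.acrossEnd else x

@[simp] theorem acrossEnd_fst {α : Type*} (x : Corner α) : x.acrossEnd.1 = x.1 := rfl

@[simp] theorem alongSide_fst {α : Type*} (x : Corner α) : x.alongSide.1 = x.1 := rfl

@[simp] theorem alongSide_alongSide {α : Type*} (x : Corner α) :
    x.alongSide.alongSide = x := by
  simp [alongSide]

@[simp] theorem swapOn_fst {α : Type*} [DecidableEq α] (A : Finset α) (x : Corner α) :
    (swapOn A x).1 = x.1 := by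
  unfold swapOn; split_ifs <;> rfl

@[simp] theorem swapOn_swapOn {α : Type*} [DecidableEq α] (A : Finset α) (x : Corner α) :
    swapOn A (swapOn A x) = x := by
  obtain ⟨e, i, s⟩ := x
  by_cases h : e ∈ A <;> cases i <;> simp [swapOn, acrossEnd, h]

end Corner

/-- A finite ribbon graph (possibly non-orientable, loops and parallel edges allowed) with edges
labelled in `α`. The boundary circle of a vertex-disc that meets some edge-ribbon consists
alternately of ends of ribbons and of arcs running from a corner of one end to a corner of the
next end; `arc` sends each corner to the corner at the other extremity of its arc. Gluing discs
along the circles so described recovers the surface, with its vertex-discs and ribbons, up to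
homeomorphism. Corners over labels that are not edges are fixed by `arc`. The vertex-discs that
meet no ribbon are only counted. -/
structure RibbonGraph (α : Type*) where
  edges : Finset α
  arc : Corner α → Corner α
  arc_arc : ∀ x, arc (arc x) = x
  arc_eq_self_iff : ∀ x, arc x = x ↔ x.1 ∉ edges
  isolated : ℕ

namespace RibbonGraph

variable {α : Type*}

/-- The corners of the ribbons of `G`. -/
abbrev Corners (G : RibbonGraph α) : Type _ := {x : Corner α // x.1 ∈ G.edges}

/-- Vertex-discs: boundary circles made of ends and arcs, together with the discs that meet no
ribbon. -/
abbrev Vertex (G : RibbonGraph α) : Type _ :=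
  Quot (fun x y : G.Corners => y.1 = G.arc x.1 ∨ y.1 = x.1.acrossEnd) ⊕ Fin G.isolated

/-- Faces, that is boundary components of the surface: circles made of arcs and free sides,
together with the boundaries of the discs that meet no ribbon. -/
abbrev Face (G : RibbonGraph α) : Type _ :=
  Quot (fun x y : G.Corners => y.1 = G.arc x.1 ∨ y.1 = x.1.alongSide) ⊕ Fin G.isolated

/-- Connected components. -/
abbrev Component (G : RibbonGraph α) : Type _ :=
  Quot (fun x y : G.Corners =>
    y.1 = G.arc x.1 ∨ y.1 = x.1.acrossEnd ∨ y.1 = x.1.alongSide) ⊕ Fin G.isolated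

/-- The number `|V(G)|` of vertices. -/
noncomputable def numVertices (G : RibbonGraph α) : ℕ := Nat.card G.Vertex

/-- The number `|F(G)|` of faces. -/
noncomputable def numFaces (G : RibbonGraph α) : ℕ := Nat.card G.Face

/-- The number `c(G)` of connected components. -/
noncomputable def numComponents (G : RibbonGraph α) : ℕ := Nat.card G.Component

/-- `G` is connected (and not void). -/
def Connected (G : RibbonGraph α) : Prop := G.numComponents = 1

/-- A bouquet is a ribbon graph with exactly one vertex. -/
def IsBouquet (G : RibbonGraph α) : Prop := G.numVertices = 1

/-- The Euler characteristic `χ(G) = |V(G)| - |E(G)| + |F(G)|`. -/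
noncomputable def eulerChar (G : RibbonGraph α) : ℤ :=
  (G.numVertices : ℤ) - (G.edges.card : ℤ) + (G.numFaces : ℤ)

/-- The Euler genus `ε(G) = 2 c(G) - χ(G)`. -/
noncomputable def eulerGenus (G : RibbonGraph α) : ℤ :=
  2 * (G.numComponents : ℤ) - G.eulerChar

/-- The partial Petrial of `G` with respect to `A`: for each edge-ribbon in `A`, one of its ends is
detached, the ribbon is given a half-twist and the end is reattached, so that the two corners
of that end change places. -/
def petrial [DecidableEq α] (G : RibbonGraph α) (A : Finset α) : RibbonGraph α where
  edges := G.edges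
  arc x := Corner.swapOn A (G.arc (Corner.swapOn A x))
  arc_arc x := by simp [G.arc_arc]
  arc_eq_self_iff x := by
    rw [← Corner.swapOn_fst A x, ← G.arc_eq_self_iff]
    constructor
    · intro h
      rw [← Corner.swapOn_swapOn A (G.arc _), h]
    · intro h
      rw [h, Corner.swapOn_swapOn]
  isolated := G.isolated

/-- The partial Petrial polynomial, the sum of `z ^ ε` over all partial Petrials of `G`
(the Euler genus of a ribbon graph is never negative). -/
noncomputable def petrialPoly [DecidableEq α] (G : RibbonGraph α) : Polynomial ℤ :=
  ∑ A ∈ G.edges.powerset, Polynomial.X ^ (G.petrial A).eulerGenus.toNat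

/-- The vertex-disc to which the end `i` of the edge-ribbon `e` is attached. -/
def endVertex (G : RibbonGraph α) (e : G.edges) (i : Bool) : G.Vertex :=
  Sum.inl (Quot.mk _ ⟨(e.1, i, false), e.2⟩)

/-- The unordered pair of the vertices joined by the edge `e`. -/
def ends (G : RibbonGraph α) (e : G.edges) : Sym2 G.Vertex :=
  s(G.endVertex e false, G.endVertex e true)

/-- `T` is the edge set of a spanning tree of `G`: it has no loops and no parallel edges, and the
simple graph it forms on the set of all vertices of `G` is a tree. -/
structure IsSpanningTree (G : RibbonGraph α) (T : Finset α) : Prop where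
  subset : T ⊆ G.edges
  not_loop : ∀ e : G.edges, e.1 ∈ T → ¬ (G.ends e).IsDiag
  not_parallel : ∀ e f : G.edges, e.1 ∈ T → f.1 ∈ T → G.ends e = G.ends f → e = f
  isTree : (SimpleGraph.fromEdgeSet {p | ∃ e : G.edges, e.1 ∈ T ∧ G.ends e = p}).IsTree

/-- If the corner `y` belongs to the ribbon `e`, run along the free side of `e` through `y` and then
along the following arc; otherwise stay at `y`. -/
def passThrough [DecidableEq α] (G : RibbonGraph α) (e : α) (y : Corner α) : Corner α :=
  if y.1 = e then G.arc y.alongSide else y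

theorem passThrough_of_ne [DecidableEq α] (G : RibbonGraph α) {e : α} {y : Corner α}
    (h : y.1 ≠ e) : G.passThrough e y = y := if_neg h

theorem passThrough_of_eq [DecidableEq α] (G : RibbonGraph α) {e : α} {y : Corner α}
    (h : y.1 = e) : G.passThrough e y = G.arc y.alongSide := if_pos h

/-- Extremity of the arc issuing from the corner `x` in the contraction of `e`. -/
def contractArc [DecidableEq α] (G : RibbonGraph α) (e : α) (x : Corner α) : Corner α :=
  if x.1 = e then x else G.passThrough e (G.passThrough e (G.arc x))

theorem mem_of_arc_ne (G : RibbonGraph α) {x : Corner α} (h : G.arc x ≠ x) : x.1 ∈ G.edges := by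
  by_contra h'
  exact h ((G.arc_eq_self_iff x).2 h')

theorem alongSide_ne (x : Corner α) : x.alongSide ≠ x := by
  obtain ⟨e, i, s⟩ := x
  simp [Corner.alongSide]

theorem fst_eq_cases {y z w : Corner α} (hz : z.1 = y.1) (hw : w.1 = y.1)
    (h1 : z ≠ y) (h2 : z ≠ y.alongSide) :
    w = y ∨ w = y.alongSide ∨ w = z ∨ w = z.alongSide := by
  obtain ⟨e, i, s⟩ := y
  obtain ⟨f, j, t⟩ := z
  obtain ⟨g, k, u⟩ := w
  obtain rfl : f = e := hz
  obtain rfl : g = f := hw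
  cases i <;> cases j <;> cases k <;> cases s <;> cases t <;> cases u <;>
    simp_all [Corner.alongSide]

theorem contractArc_spec [DecidableEq α] (G : RibbonGraph α) (e : α) (x : Corner α)
    (hx : x.1 ≠ e) : (G.contractArc e x).1 ≠ e ∧
      G.contractArc e (G.contractArc e x) = x ∧
      (G.contractArc e x = x ↔ x.1 ∉ G.edges) := by
  have aa := G.arc_arc
  have ne_of : ∀ y : Corner α, y.1 ∈ G.edges → G.arc y ≠ y := fun y hy h =>
    (G.arc_eq_self_iff y).1 h hy
  by_cases hxm : x.1 ∈ G.edges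
  · suffices h : (G.contractArc e x).1 ≠ e ∧ G.contractArc e (G.contractArc e x) = x ∧
        G.contractArc e x ≠ x from ⟨h.1, h.2.1, fun h' => absurd h' h.2.2, fun h' => absurd hxm h'⟩
    obtain ⟨y, hy⟩ : ∃ y, y = G.arc x := ⟨_, rfl⟩
    have hxy : G.arc y = x := by rw [hy, aa]
    have hyx : y ≠ x := fun h => ne_of x hxm (by rw [← hy, h])
    have hym : y.1 ∈ G.edges := G.mem_of_arc_ne (by rw [hxy]; exact hyx.symm)
    by_cases hye : y.1 = e
    · obtain ⟨z, hz⟩ : ∃ z, z = G.arc y.alongSide := ⟨_, rfl⟩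
      have hzy : G.arc z = y.alongSide := by rw [hz, aa]
      have e1 : G.contractArc e x = G.passThrough e z := by
        rw [contractArc, if_neg hx, ← hy, G.passThrough_of_eq hye, ← hz]
      by_cases hze : z.1 = e
      · obtain ⟨w, hw⟩ : ∃ w, w = G.arc z.alongSide := ⟨_, rfl⟩
        have hwz : G.arc w = z.alongSide := by rw [hw, aa]
        have e2 : G.contractArc e x = w := by rw [e1, G.passThrough_of_eq hze, ← hw]
        have h1 : z ≠ y := by
          intro h
          apply hx
          rw [← hxy, ← h, hzy]; exact hye
        have h2 : z ≠ y.alongSide := by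
          intro h
          exact ne_of y.alongSide hym (by rw [← hz, h])
        have hwe : w.1 ≠ e := by
          intro hwe
          rcases fst_eq_cases (hze.trans hye.symm) (hwe.trans hye.symm) h1 h2 with h | h | h | h
          · apply hx
            rw [← hxy, ← h, hwz]; exact hze
          · rw [h, ← hz] at hwz
            exact alongSide_ne z hwz.symm
          · rw [h, hzy] at hwz
            apply h1
            rw [← Corner.alongSide_alongSide z, ← hwz, Corner.alongSide_alongSide]
          · refine ne_of z.alongSide ?_ (by rw [← hw, h])
            rw [Corner.alongSide_fst, hze, ← hye]; exact hym
        refine ⟨by rw [e2]; exact hwe, ?_, ?_⟩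
        · rw [e2, contractArc, if_neg hwe, hwz, G.passThrough_of_eq (y := z.alongSide) hze,
            Corner.alongSide_alongSide, hzy, G.passThrough_of_eq (y := y.alongSide) hye,
            Corner.alongSide_alongSide, hxy]
        · rw [e2]
          intro h
          rw [h, ← hy] at hwz
          apply h2
          rw [hwz, Corner.alongSide_alongSide]
      · have e2 : G.contractArc e x = z := by rw [e1, G.passThrough_of_ne hze]
        refine ⟨by rw [e2]; exact hze, ?_, ?_⟩
        · rw [e2, contractArc, if_neg hze, hzy, G.passThrough_of_eq (y := y.alongSide) hye,
            Corner.alongSide_alongSide, hxy, G.passThrough_of_ne hx]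
        · rw [e2]
          intro h
          rw [h, ← hy] at hzy
          exact alongSide_ne y hzy.symm
    · have e1 : G.contractArc e x = y := by
        rw [contractArc, if_neg hx, ← hy, G.passThrough_of_ne hye, G.passThrough_of_ne hye]
      refine ⟨by rw [e1]; exact hye, ?_, by rw [e1]; exact hyx⟩
      rw [e1, contractArc, if_neg hye, hxy, G.passThrough_of_ne hx, G.passThrough_of_ne hx]
  · have e1 : G.contractArc e x = x := by
      rw [contractArc, if_neg hx, (G.arc_eq_self_iff x).2 hxm, G.passThrough_of_ne hx,
        G.passThrough_of_ne hx]
    exact ⟨by rw [e1]; exact hx, by rw [e1, e1], fun _ => hxm, fun _ => e1⟩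

/-- The contraction `G/e` of an edge-ribbon `e` joining two distinct vertex-discs `u` and `v`
(the operation is used only for such `e`): `e`, `u`, `v` are replaced by the single vertex-disc
`e ∪ u ∪ v`. An arc of its boundary runs along the boundary of `u ∪ v` and, each time it reaches
a corner of `e`, continues along the free side of `e`, which can happen at most twice (once for
each side of `e`) before the end of another ribbon is reached. The disc `e ∪ u ∪ v` meets no
ribbon exactly when `e` has the only end on `u` and the only end on `v`. -/
def contract [DecidableEq α] (G : RibbonGraph α) (e : α) : RibbonGraph α where
  edges := G.edges.erase e
  arc := G.contractArc e
  arc_arc x := by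
    by_cases hx : x.1 = e
    · have : G.contractArc e x = x := if_pos hx
      rw [this, this]
    · exact (G.contractArc_spec e x hx).2.1
  arc_eq_self_iff x := by
    by_cases hx : x.1 = e
    · have : G.contractArc e x = x := if_pos hx
      simp [this, hx]
    · rw [(G.contractArc_spec e x hx).2.2]
      simp [hx]
  isolated := G.isolated +
    if ∀ i s : Bool, G.arc (e, i, s) = Corner.acrossEnd (e, i, s) then 1 else 0

/-- The auxiliary bouquet `Aux(G,T)`: all the edges of the spanning tree `T` are contracted, one
after the other, in the order in which the list `l` enumerates them. -/
def aux [DecidableEq α] (G : RibbonGraph α) (l : List α) : RibbonGraph α :=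
  l.foldl contract G

/-- The next corner met when going around a vertex-disc: cross the end at `x`, then follow the arc.
Until it closes up, this walk visits every end on the vertex-disc exactly once, in the cyclic
order of the rotation. -/
def next (G : RibbonGraph α) (x : Corner α) : Corner α := G.arc x.acrossEnd

/-- The half-edges of `a` and `b` alternate in the rotation: going once around the vertex-disc
from an end of `a` one meets `a, b, a, b` in this cyclic order. -/
def Interlaced (G : RibbonGraph α) (a b : α) : Prop :=
  ∃ (x : Corner α) (i j k : ℕ), 0 < i ∧ i < j ∧ j < k ∧ k < Function.minimalPeriod G.next x ∧
    x.1 = a ∧ (G.next^[i] x).1 = b ∧ (G.next^[j] x).1 = a ∧ (G.next^[k] x).1 = b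

/-- The intersection graph `I(B)` of a bouquet: distinct loops are adjacent when interlaced. -/
def intersectionGraph (B : RibbonGraph α) : SimpleGraph B.edges :=
  SimpleGraph.fromRel (fun a b => B.Interlaced a.1 b.1)

open Classical in
/-- The adjacency matrix over `GF(2)` of the intersection graph. -/
noncomputable def adjI (B : RibbonGraph α) : Matrix B.edges B.edges (ZMod 2) :=
  B.intersectionGraph.adjMatrix (ZMod 2)

/-- The diagonal matrix `D_Y`, with entry `1` at the edges in `Y` and `0` at the others. -/
def diagOf [DecidableEq α] (B : RibbonGraph α) (Y : Finset α) :
    Matrix B.edges B.edges (ZMod 2) :=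
  Matrix.diagonal (fun e => if e.1 ∈ Y then 1 else 0)

end RibbonGraph

/-!
Contracting a ribbon that is not a loop only merges two vertex-discs into one: the boundary
components, the connected components and hence the Euler genus do not change. The contraction of `e`
also commutes with twisting ribbons other than `e`, so that, splitting `A` into `X = A ∩ T` and
`Y = A \ T`, the Euler genus of `G^{×|A}` is that of `Aux(G^{×|X}, T)^{×|Y}`. This gives the first
identity.

For the second one, let `B` have one vertex-disc in each component. For each edge `b`, counting
modulo 2 the ends of `b` met along a vertex-disc gives a function `φ b` on its boundary, which is
well defined because `b` is a loop. The matrix `M` of the variations of the `φ b` between the two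
ends of each edge is the adjacency matrix of the intersection graph, up to the diagonal, and
twisting along `Y` adds `D_Y` to it. A function of the faces with values in `GF(2)` has a jump at
each ribbon; the vectors of jumps are exactly the kernel of `M`, and the functions without jumps are
those that are constant on each component. By rank-nullity the Euler genus of `B` is the rank of
`M`.
-/

section Counting

open Set

variable {X Y Z : Type*}

theorem ncard_image_le_of_imp {C : Set X} (hC : C.Finite) {f : X → Y} {g : X → Z}
    (h : ∀ x ∈ C, ∀ y ∈ C, f x = f y → g x = g y) : (g '' C).ncard ≤ (f '' C).ncard := by
  have hinj : InjOn Prod.fst ((fun x => (f x, g x)) '' C) := by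
    rintro _ ⟨x, hx, rfl⟩ _ ⟨y, hy, rfl⟩ hxy
    exact Prod.ext hxy (h x hx y hy hxy)
  calc (g '' C).ncard = (Prod.snd '' ((fun x => (f x, g x)) '' C)).ncard := by rw [image_image]
    _ ≤ ((fun x => (f x, g x)) '' C).ncard := ncard_image_le (hC.image _)
    _ = (f '' C).ncard := by rw [← hinj.ncard_image, image_image]

theorem ncard_image_congr {C : Set X} (hC : C.Finite) {f : X → Y} {g : X → Z}
    (h : ∀ x ∈ C, ∀ y ∈ C, f x = f y ↔ g x = g y) : (f '' C).ncard = (g '' C).ncard :=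
  (ncard_image_le_of_imp hC fun x hx y hy => (h x hx y hy).2).antisymm
    (ncard_image_le_of_imp hC fun x hx y hy => (h x hx y hy).1)

theorem image_update_id [DecidableEq X] {s : Set X} {p q : X} (hp : p ∈ s) (hpq : p ≠ q) :
    Function.update id q p '' s = s \ {q} := by
  ext z
  simp only [mem_image, mem_sdiff, mem_singleton_iff, Function.update_apply, id]
  constructor
  · rintro ⟨w, hw, rfl⟩
    split_ifs with hwq
    exacts [⟨hp, hpq⟩, ⟨hw, hwq⟩]
  · rintro ⟨hz, hzq⟩
    exact ⟨z, hz, if_neg hzq⟩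

theorem natCard_quot_subtype {r : X → X → Prop} {C : Set X}
    (hC : ∀ x y, r x y → (x ∈ C ↔ y ∈ C)) :
    Nat.card (Quot fun x y : C => r x y) = (Quot.mk r '' C).ncard := by
  classical
  let toQuot : (Quot fun x y : C => r x y) → Quot r :=
    Quot.lift (fun x => Quot.mk r x) fun _ _ h => Quot.sound h
  let retract : Quot r → Option (Quot fun x y : C => r x y) :=
    Quot.lift (fun x => if h : x ∈ C then some (Quot.mk _ ⟨x, h⟩) else none) fun x y hxy => by
      by_cases hx : x ∈ C
      · have hy : y ∈ C := (hC x y hxy).1 hx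
        simp only [hx, hy, dif_pos, Option.some.injEq]
        exact Quot.sound hxy
      · have hy : y ∉ C := fun hy => hx ((hC x y hxy).2 hy)
        simp only [hx, hy, dif_neg, not_false_eq_true]
  have hretract (q) : retract (toQuot q) = some q := by
    obtain ⟨x, hx⟩ := q
    exact dif_pos hx
  have hinj : Function.Injective toQuot := fun p q hpq =>
    Option.some_injective _ (by rw [← hretract, hpq, hretract])
  have hrange : range toQuot = Quot.mk r '' C := by
    ext q
    exact ⟨by rintro ⟨⟨x⟩, rfl⟩; exact ⟨x, x.2, rfl⟩,
      by rintro ⟨x, hx, rfl⟩; exact ⟨Quot.mk _ ⟨x, hx⟩, rfl⟩⟩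
  rw [← hrange, ← Nat.card_coe_set_eq, Nat.card_range_of_injective hinj]

theorem sum_powerset_eq_sum_powerset_sdiff [DecidableEq X] {M : Type*} [AddCommMonoid M]
    {s t : Finset X} (hts : t ⊆ s) (f : Finset X → M) :
    ∑ a ∈ s.powerset, f a = ∑ x ∈ t.powerset, ∑ y ∈ (s \ t).powerset, f (x ∪ y) := by
  rw [← Finset.sum_product']
  refine Finset.sum_bij' (fun a _ => (a ∩ t, a \ t)) (fun p _ => p.1 ∪ p.2) ?_ ?_ ?_ ?_ ?_
  · intro a ha
    simp only [Finset.mem_product, Finset.mem_powerset] at ha ⊢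
    exact ⟨Finset.inter_subset_right, Finset.sdiff_subset_sdiff ha subset_rfl⟩
  · intro p hp
    simp only [Finset.mem_product, Finset.mem_powerset] at hp ⊢
    exact Finset.union_subset (hp.1.trans hts) (hp.2.trans Finset.sdiff_subset)
  · intro a _
    rw [Finset.union_comm, Finset.sdiff_union_inter]
  · rintro ⟨x, y⟩ hp
    simp only [Finset.mem_product, Finset.mem_powerset] at hp
    have hyt : Disjoint y t := Finset.sdiff_disjoint.mono_left hp.2
    have hxy : x ∩ t = x := Finset.inter_eq_left.2 hp.1
    have hx : x \ t = ∅ := Finset.sdiff_eq_empty_iff_subset.2 hp.1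
    simp only [Finset.union_inter_distrib_right, Finset.union_sdiff_distrib, hxy, hx,
      Finset.disjoint_iff_inter_eq_empty.1 hyt, hyt.sdiff_eq_left, Finset.union_empty,
      Finset.empty_union]
  · intro a _
    rw [Finset.union_comm, Finset.sdiff_union_inter]

end Counting

namespace Corner

variable {α : Type*}

@[simp] theorem acrossEnd_acrossEnd (x : Corner α) : x.acrossEnd.acrossEnd = x := by
  simp [acrossEnd]

theorem acrossEnd_ne (x : Corner α) : x.acrossEnd ≠ x := by
  obtain ⟨e, i, s⟩ := x
  simp [acrossEnd]

theorem acrossEnd_inj {x y : Corner α} : x.acrossEnd = y.acrossEnd ↔ x = y :=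
  ⟨fun h => by rw [← acrossEnd_acrossEnd x, h, acrossEnd_acrossEnd], fun h => by rw [h]⟩

theorem eq_or_eq_acrossEnd {x y : Corner α} (h : x.1 = y.1) (hend : x.2.1 = y.2.1) :
    y = x ∨ y = x.acrossEnd := by
  obtain ⟨e, i, s⟩ := x
  obtain ⟨f, j, t⟩ := y
  obtain rfl : e = f := h
  obtain rfl : i = j := hend
  cases s <;> cases t <;> simp [acrossEnd]

variable [DecidableEq α]

theorem swapOn_of_notMem {A : Finset α} {x : Corner α} (h : x.1 ∉ A) : swapOn A x = x :=
  if_neg fun h' => h h'.1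

theorem swapOn_eq_or (A : Finset α) (x : Corner α) :
    swapOn A x = x ∨ swapOn A x = x.acrossEnd := by
  unfold swapOn; split_ifs <;> simp

theorem swapOn_acrossEnd (A : Finset α) (x : Corner α) :
    swapOn A x.acrossEnd = (swapOn A x).acrossEnd := by
  obtain ⟨e, i, s⟩ := x
  by_cases h : e ∈ A <;> cases i <;> simp [swapOn, acrossEnd, h]

theorem swapOn_union {A B : Finset α} (h : Disjoint A B) (x : Corner α) :
    swapOn (A ∪ B) x = swapOn B (swapOn A x) := by
  obtain ⟨e, i, s⟩ := x
  have hAB : e ∈ A → e ∉ B := fun hA => Finset.disjoint_left.1 h hA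
  by_cases hA : e ∈ A <;> by_cases hB : e ∈ B <;> cases i <;>
    simp_all [swapOn, acrossEnd]

end Corner

namespace RibbonGraph

variable {α : Type*}

section Classes

variable (G : RibbonGraph α) {S T S' T' : Set α} {x y : Corner α}

theorem arc_ne (hx : x.1 ∈ G.edges) : G.arc x ≠ x :=
  fun h => (G.arc_eq_self_iff x).1 h hx

theorem arc_mem (hx : x.1 ∈ G.edges) : (G.arc x).1 ∈ G.edges :=
  G.mem_of_arc_ne (by rw [G.arc_arc]; exact (G.arc_ne hx).symm)

theorem arc_mem_iff : (G.arc x).1 ∈ G.edges ↔ x.1 ∈ G.edges :=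
  ⟨fun h => by simpa only [G.arc_arc] using G.arc_mem h, G.arc_mem⟩

/-- The set of corners of the ribbons of `G`. -/
def corners : Set (Corner α) := {x | x.1 ∈ G.edges}

theorem finite_corners : G.corners.Finite :=
  (G.edges.finite_toSet.prod (Set.finite_univ (α := Bool × Bool))).subset
    fun _ hx => ⟨hx, Set.mem_univ _⟩

instance : Finite G.Corners := G.finite_corners.to_subtype

/-- Two corners are linked if they are the extremities of an arc, or of an end of a ribbon in `S`,
or of a free side of a ribbon in `T`. The choices `univ, ∅` and `∅, univ` and `univ, univ` of `S, T`
give the vertices, the faces and the connected components of `G`. -/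
def link (S T : Set α) (x y : Corner α) : Prop :=
  x.1 ∈ G.edges ∧
    (y = G.arc x ∨ (x.1 ∈ S ∧ y = x.acrossEnd) ∨ (x.1 ∈ T ∧ y = x.alongSide))

/-- The class of a corner for the equivalence generated by `link`. -/
def cls (S T : Set α) (x : Corner α) : Quot (G.link S T) := Quot.mk _ x

/-- The number of classes of corners of `G` for the equivalence generated by `link`, increased by
the number of vertex-discs that meet no ribbon. -/
noncomputable def numClasses (S T : Set α) : ℕ :=
  (G.cls S T '' G.corners).ncard + G.isolated

theorem cls_arc (x : Corner α) : G.cls S T (G.arc x) = G.cls S T x := by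
  by_cases hx : x.1 ∈ G.edges
  · exact (Quot.sound ⟨hx, Or.inl rfl⟩).symm
  · rw [(G.arc_eq_self_iff x).2 hx]

theorem cls_acrossEnd (hx : x.1 ∈ G.edges) (hS : x.1 ∈ S) :
    G.cls S T x.acrossEnd = G.cls S T x :=
  (Quot.sound ⟨hx, Or.inr (Or.inl ⟨hS, rfl⟩)⟩).symm

theorem cls_alongSide (hx : x.1 ∈ G.edges) (hT : x.1 ∈ T) :
    G.cls S T x.alongSide = G.cls S T x :=
  (Quot.sound ⟨hx, Or.inr (Or.inr ⟨hT, rfl⟩)⟩).symm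

theorem cls_eq_of_end_eq (hx : x.1 ∈ G.edges) (hS : x.1 ∈ S) (h : x.1 = y.1)
    (hend : x.2.1 = y.2.1) : G.cls S T y = G.cls S T x := by
  obtain rfl | rfl := Corner.eq_or_eq_acrossEnd h hend
  · rfl
  · exact G.cls_acrossEnd hx hS

variable {G}

theorem apply_eq_of_cls_eq {Y : Type*} (f : Corner α → Y)
    (harc : ∀ x, x.1 ∈ G.edges → f (G.arc x) = f x)
    (hend : ∀ x, x.1 ∈ G.edges → x.1 ∈ S → f x.acrossEnd = f x)
    (hside : ∀ x, x.1 ∈ G.edges → x.1 ∈ T → f x.alongSide = f x)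
    (h : G.cls S T x = G.cls S T y) : f x = f y :=
  congrArg (Quot.lift f (by
    rintro x _ ⟨hx, rfl | ⟨hS, rfl⟩ | ⟨hT, rfl⟩⟩
    exacts [(harc x hx).symm, (hend x hx hS).symm, (hside x hx hT).symm])) h

theorem cls_mono (hS : S ⊆ S') (hT : T ⊆ T') (h : G.cls S T x = G.cls S T y) :
    G.cls S' T' x = G.cls S' T' y :=
  apply_eq_of_cls_eq _ (fun x _ => G.cls_arc x) (fun _ hx hxS => G.cls_acrossEnd hx (hS hxS))
    (fun _ hx hxT => G.cls_alongSide hx (hT hxT)) h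

variable (G)

theorem numClasses_anti (hS : S ⊆ S') (hT : T ⊆ T') : G.numClasses S' T' ≤ G.numClasses S T :=
  Nat.add_le_add_right
    (ncard_image_le_of_imp G.finite_corners fun _ _ _ _ => cls_mono hS hT) _

theorem numClasses_congr (hS : ∀ e ∈ G.edges, e ∈ S ↔ e ∈ S')
    (hT : ∀ e ∈ G.edges, e ∈ T ↔ e ∈ T') : G.numClasses S T = G.numClasses S' T' := by
  have hlink : G.link S T = G.link S' T' := by
    funext x y
    refine propext (and_congr_right fun hx => ?_)
    rw [hS _ hx, hT _ hx]
  unfold numClasses cls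
  rw [hlink]

theorem natCard_quot_corners :
    Nat.card (Quot fun x y : G.Corners => G.link S T x y) = (G.cls S T '' G.corners).ncard :=
  natCard_quot_subtype (C := G.corners) fun x y h => by
    obtain ⟨-, rfl | ⟨-, rfl⟩ | ⟨-, rfl⟩⟩ := h
    exacts [G.arc_mem_iff.symm, Iff.rfl, Iff.rfl]

theorem numVertices_eq_numClasses : G.numVertices = G.numClasses Set.univ ∅ := by
  have hlink : (fun x y : G.Corners => y.1 = G.arc x.1 ∨ y.1 = x.1.acrossEnd) =
      fun x y : G.Corners => G.link Set.univ ∅ x y := by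
    funext x y; simp [link, x.2]
  rw [numVertices, Vertex, hlink, Nat.card_sum, Nat.card_fin, numClasses, natCard_quot_corners]

theorem numFaces_eq_numClasses : G.numFaces = G.numClasses ∅ Set.univ := by
  have hlink : (fun x y : G.Corners => y.1 = G.arc x.1 ∨ y.1 = x.1.alongSide) =
      fun x y : G.Corners => G.link ∅ Set.univ x y := by
    funext x y; simp [link, x.2]
  rw [numFaces, Face, hlink, Nat.card_sum, Nat.card_fin, numClasses, natCard_quot_corners]

theorem numComponents_eq_numClasses : G.numComponents = G.numClasses Set.univ Set.univ := by
  have hlink : (fun x y : G.Corners =>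
      y.1 = G.arc x.1 ∨ y.1 = x.1.acrossEnd ∨ y.1 = x.1.alongSide) =
      fun x y : G.Corners => G.link Set.univ Set.univ x y := by
    funext x y; simp [link, x.2]
  rw [numComponents, Component, hlink, Nat.card_sum, Nat.card_fin, numClasses,
    natCard_quot_corners]

end Classes

section InsertSide

variable (G : RibbonGraph α) {e : α} {T : Set α}

open Classical in
/-- The map that moves the class of the end `true` of the ribbon `e` to the class of its end
`false`: its fibres are the classes that remain when the free sides of `e` become links. -/
noncomputable def mergeEnds (G : RibbonGraph α) (e : α) (T : Set α) :
    Quot (G.link Set.univ T) → Quot (G.link Set.univ T) :=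
  Function.update id (G.cls Set.univ T (e, true, false)) (G.cls Set.univ T (e, false, false))

theorem cls_univ_insert_eq_iff (he : e ∈ G.edges) {x y : Corner α} :
    G.cls Set.univ (insert e T) x = G.cls Set.univ (insert e T) y ↔
      G.mergeEnds e T (G.cls Set.univ T x) = G.mergeEnds e T (G.cls Set.univ T y) := by
  classical
  have hends (i s : Bool) : G.cls Set.univ T (e, i, s) = G.cls Set.univ T (e, i, false) :=
    G.cls_eq_of_end_eq (x := (e, i, false)) he (Set.mem_univ e) rfl rfl
  have hmerge (i s : Bool) :
      G.mergeEnds e T (G.cls Set.univ T (e, i, s)) = G.cls Set.univ T (e, false, false) := by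
    rw [hends]
    cases i <;> simp [mergeEnds, Function.update_apply]
  have hlift (z : Corner α) : ∃ w, G.mergeEnds e T (G.cls Set.univ T z) = G.cls Set.univ T w ∧
      G.cls Set.univ (insert e T) w = G.cls Set.univ (insert e T) z := by
    by_cases hz : G.cls Set.univ T z = G.cls Set.univ T (e, true, false)
    · refine ⟨(e, false, false), by rw [hz, hmerge], ?_⟩
      rw [cls_mono subset_rfl (Set.subset_insert e T) hz]
      exact G.cls_alongSide (x := (e, true, false)) he (Set.mem_insert e T)
    · exact ⟨z, Function.update_of_ne hz _ _, rfl⟩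
  constructor
  · refine apply_eq_of_cls_eq (fun z => G.mergeEnds e T (G.cls Set.univ T z))
      (fun z _ => congrArg (G.mergeEnds e T) (G.cls_arc z))
      (fun z hz _ => congrArg (G.mergeEnds e T) (G.cls_acrossEnd hz (Set.mem_univ _))) ?_
    rintro ⟨f, i, s⟩ hz (rfl | hT)
    · exact (hmerge _ _).trans (hmerge _ _).symm
    · exact congrArg (G.mergeEnds e T) (G.cls_alongSide hz hT)
  · intro hxy
    obtain ⟨v, hv, hvx⟩ := hlift x
    obtain ⟨w, hw, hwy⟩ := hlift y
    rw [← hvx, ← hwy]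
    exact cls_mono subset_rfl (Set.subset_insert e T) (hv.symm.trans (hxy.trans hw))

theorem numClasses_univ_insert_of_cls_eq (he : e ∈ G.edges)
    (h : G.cls Set.univ T (e, false, false) = G.cls Set.univ T (e, true, false)) :
    G.numClasses Set.univ (insert e T) = G.numClasses Set.univ T := by
  classical
  have hmerge : G.mergeEnds e T = id := by
    rw [mergeEnds, h]
    exact Function.update_eq_self _ _
  refine congrArg (· + _) (ncard_image_congr G.finite_corners fun x _ y _ => ?_)
  rw [G.cls_univ_insert_eq_iff he, hmerge, id, id]

theorem numClasses_univ_insert_add_one (he : e ∈ G.edges)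
    (h : G.cls Set.univ T (e, false, false) ≠ G.cls Set.univ T (e, true, false)) :
    G.numClasses Set.univ (insert e T) + 1 = G.numClasses Set.univ T := by
  classical
  have hmem (i : Bool) : G.cls Set.univ T (e, i, false) ∈ G.cls Set.univ T '' G.corners :=
    ⟨_, he, rfl⟩
  rw [numClasses, numClasses, add_right_comm,
    ncard_image_congr G.finite_corners fun x _ y _ => G.cls_univ_insert_eq_iff he,
    ← Set.image_image (G.mergeEnds e T), mergeEnds, image_update_id (hmem false) h,
    Set.ncard_sdiff_singleton_add_one (hmem true) (G.finite_corners.image _)]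

theorem numClasses_univ_empty_le_add_card (T : Finset α) (hT : T ⊆ G.edges) :
    G.numClasses Set.univ ∅ ≤ G.numClasses Set.univ T + T.card := by
  classical
  induction T using Finset.induction_on with
  | empty => simp
  | insert e T heT ih =>
    have ih := ih ((Finset.subset_insert _ _).trans hT)
    have he : e ∈ G.edges := hT (Finset.mem_insert_self _ _)
    rw [Finset.card_insert_of_notMem heT, Finset.coe_insert]
    by_cases h : G.cls Set.univ T (e, false, false) = G.cls Set.univ T (e, true, false)
    · rw [G.numClasses_univ_insert_of_cls_eq he h]
      omega
    · have := G.numClasses_univ_insert_add_one he h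
      omega

end InsertSide

section Walk

variable (G : RibbonGraph α) {x : Corner α}

theorem next_injective : Function.Injective G.next := fun x y h =>
  Corner.acrossEnd_inj.1 (by simpa only [next, G.arc_arc] using congrArg G.arc h)

theorem iterate_next_mem (hx : x.1 ∈ G.edges) (k : ℕ) : (G.next^[k] x).1 ∈ G.edges := by
  induction k with
  | zero => exact hx
  | succ k ih =>
    rw [Function.iterate_succ_apply']
    exact G.arc_mem (x := (G.next^[k] x).acrossEnd) ih

theorem arc_iterate_next_succ (x : Corner α) (k : ℕ) :
    G.arc (G.next^[k + 1] x) = (G.next^[k] x).acrossEnd := by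
  rw [Function.iterate_succ_apply', next, G.arc_arc]

theorem arc_acrossEnd_iterate_next (x : Corner α) (k : ℕ) :
    G.arc (G.next^[k] x).acrossEnd = G.next^[k + 1] x := by
  rw [Function.iterate_succ_apply', next]

theorem iterate_next_acrossEnd_iterate (x : Corner α) (m : ℕ) :
    G.next^[m] (G.next^[m] x).acrossEnd = x.acrossEnd := by
  induction m with
  | zero => rfl
  | succ m ih =>
    rw [Function.iterate_succ_apply, next, Corner.acrossEnd_acrossEnd, arc_iterate_next_succ, ih]

theorem iterate_next_ne_acrossEnd (hx : x.1 ∈ G.edges) (k : ℕ) : G.next^[k] x ≠ x.acrossEnd := by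
  intro h
  rcases Nat.even_or_odd' k with ⟨m, rfl | rfl⟩
  · rw [two_mul, Function.iterate_add_apply, ← G.iterate_next_acrossEnd_iterate x m] at h
    exact Corner.acrossEnd_ne _ (G.next_injective.iterate m h).symm
  · rw [two_mul, add_assoc, Function.iterate_add_apply,
      ← G.iterate_next_acrossEnd_iterate x m] at h
    have h' := G.next_injective.iterate m h
    rw [Function.iterate_succ_apply'] at h'
    exact G.arc_ne (x := (G.next^[m] x).acrossEnd) (G.iterate_next_mem hx m) h'

theorem iterate_next_ne_acrossEnd_iterate (hx : x.1 ∈ G.edges) (s t : ℕ) :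
    G.next^[t] x ≠ (G.next^[s] x).acrossEnd := by
  intro h
  rcases le_total s t with hst | hst
  · obtain ⟨k, rfl⟩ := Nat.exists_eq_add_of_le' hst
    rw [Function.iterate_add_apply] at h
    exact G.iterate_next_ne_acrossEnd (G.iterate_next_mem hx s) k h
  · obtain ⟨k, rfl⟩ := Nat.exists_eq_add_of_le' hst
    rw [Function.iterate_add_apply] at h
    refine G.iterate_next_ne_acrossEnd (G.iterate_next_mem hx t) k ?_
    exact Corner.acrossEnd_inj.1 (by rw [Corner.acrossEnd_acrossEnd, ← h])

theorem mem_periodicPts_next (hx : x.1 ∈ G.edges) : x ∈ Function.periodicPts G.next := by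
  let f : G.Corners → G.Corners := fun y => ⟨G.next y.1, G.iterate_next_mem y.2 1⟩
  have hf : Function.Injective f := fun y z h =>
    Subtype.ext (G.next_injective (congrArg Subtype.val h))
  have hs : Function.Semiconj Subtype.val f G.next := fun _ => rfl
  obtain ⟨n, hn, h⟩ := hf.mem_periodicPts ⟨x, hx⟩
  exact ⟨n, hn, h.map hs⟩

theorem minimalPeriod_next_pos (hx : x.1 ∈ G.edges) : 0 < Function.minimalPeriod G.next x :=
  Function.minimalPeriod_pos_of_mem_periodicPts (G.mem_periodicPts_next hx)

theorem eq_of_iterate_next_end_eq (hx : x.1 ∈ G.edges) {s t : ℕ}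
    (hs : s < Function.minimalPeriod G.next x) (ht : t < Function.minimalPeriod G.next x)
    (h : (G.next^[s] x).1 = (G.next^[t] x).1) (hend : (G.next^[s] x).2.1 = (G.next^[t] x).2.1) :
    s = t := by
  obtain h | h := Corner.eq_or_eq_acrossEnd h.symm hend.symm
  · exact Function.iterate_injOn_Iio_minimalPeriod hs ht h
  · exact absurd h (G.iterate_next_ne_acrossEnd_iterate hx t s)

theorem eq_of_iterate_next_fst_eq (hx : x.1 ∈ G.edges) {s t u : ℕ}
    (hs : s < Function.minimalPeriod G.next x) (ht : t < Function.minimalPeriod G.next x)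
    (hu : u < Function.minimalPeriod G.next x) (hst : (G.next^[s] x).1 = (G.next^[t] x).1)
    (hut : (G.next^[u] x).1 = (G.next^[t] x).1) (hst' : s ≠ t) (hut' : u ≠ t) : s = u := by
  refine G.eq_of_iterate_next_end_eq hx hs hu (hst.trans hut.symm) ?_
  have hs_end := mt (G.eq_of_iterate_next_end_eq hx hs ht hst) hst'
  have hu_end := mt (G.eq_of_iterate_next_end_eq hx hu ht hut) hut'
  exact (Bool.eq_not_of_ne hs_end).trans (Bool.eq_not_of_ne hu_end).symm

theorem cls_univ_iterate_next {T : Set α} (hx : x.1 ∈ G.edges) (k : ℕ) :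
    G.cls Set.univ T (G.next^[k] x) = G.cls Set.univ T x := by
  induction k with
  | zero => rfl
  | succ k ih =>
    rw [Function.iterate_succ_apply', next, G.cls_arc,
      G.cls_acrossEnd (G.iterate_next_mem hx k) (Set.mem_univ _), ih]

theorem exists_iterate_next_of_cls_eq (hx : x.1 ∈ G.edges) {y : Corner α}
    (hxy : G.cls Set.univ ∅ x = G.cls Set.univ ∅ y) :
    ∃ k < Function.minimalPeriod G.next x,
      y = G.next^[k] x ∨ y = (G.next^[k] x).acrossEnd := by
  let visited (z : Corner α) : Prop := ∃ k, z = G.next^[k] x ∨ z = (G.next^[k] x).acrossEnd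
  have hpos := G.minimalPeriod_next_pos hx
  have visited_arc {z} : visited z → visited (G.arc z) := by
    rintro ⟨k, rfl | rfl⟩
    · refine ⟨k + (Function.minimalPeriod G.next x - 1), Or.inr ?_⟩
      rw [← arc_iterate_next_succ, add_assoc, Nat.sub_add_cancel hpos,
        Function.iterate_add_apply, Function.iterate_minimalPeriod]
    · exact ⟨k + 1, Or.inl (G.arc_acrossEnd_iterate_next x k)⟩
  have visited_acrossEnd {z} : visited z → visited z.acrossEnd := by
    rintro ⟨k, rfl | rfl⟩
    · exact ⟨k, Or.inr rfl⟩
    · exact ⟨k, Or.inl (Corner.acrossEnd_acrossEnd _)⟩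
  have hvisited : visited x = visited y := apply_eq_of_cls_eq visited
    (fun z _ => propext ⟨fun h => G.arc_arc z ▸ visited_arc h, visited_arc⟩)
    (fun z _ _ => propext ⟨fun h => z.acrossEnd_acrossEnd ▸ visited_acrossEnd h,
      visited_acrossEnd⟩) (fun _ _ h => h.elim) hxy
  obtain ⟨k, hk⟩ := hvisited.mp ⟨0, Or.inl rfl⟩
  refine ⟨k % Function.minimalPeriod G.next x, Nat.mod_lt _ hpos, ?_⟩
  rwa [Function.iterate_mod_minimalPeriod_eq]

variable {G}

theorem Interlaced.symm {a b : α} (h : G.Interlaced a b) : G.Interlaced b a := by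
  obtain ⟨x, i, j, k, hi, hij, hjk, hk, ha, hb, ha', hb'⟩ := h
  have hper : x ∈ Function.periodicPts G.next :=
    Function.minimalPeriod_pos_iff_mem_periodicPts.1 (by omega)
  refine ⟨G.next^[i] x, j - i, k - i, Function.minimalPeriod G.next x - i,
    by omega, by omega, by omega, ?_, hb, ?_, ?_, ?_⟩
  · rw [Function.minimalPeriod_apply_iterate hper]; omega
  all_goals rw [← Function.iterate_add_apply, Nat.sub_add_cancel (by omega)]
  · exact ha'
  · exact hb'
  · rw [Function.iterate_minimalPeriod]; exact ha

end Walk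

section NonLoop

variable {G : RibbonGraph α} {e : α} {x y : Corner α}

/-- Both ends of the ribbon `e` lie on the same vertex-disc. -/
def IsLoop (G : RibbonGraph α) (e : α) : Prop :=
  G.cls Set.univ ∅ (e, false, false) = G.cls Set.univ ∅ (e, true, false)

theorem eq_or_eq_acrossEnd_of_not_isLoop (he : e ∈ G.edges) (hloop : ¬ G.IsLoop e)
    (hx : x.1 = e) (hy : y.1 = e) (hxy : G.cls Set.univ ∅ x = G.cls Set.univ ∅ y) :
    y = x ∨ y = x.acrossEnd := by
  refine Corner.eq_or_eq_acrossEnd (hx.trans hy.symm) (by_contra fun hend => hloop ?_)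
  have hcls {z : Corner α} (hz : z.1 = e) :
      G.cls Set.univ ∅ z = G.cls Set.univ ∅ (e, z.2.1, false) :=
    G.cls_eq_of_end_eq (x := (e, z.2.1, false)) he (Set.mem_univ e) hz.symm rfl
  rw [hcls hx, hcls hy, Bool.eq_not_of_ne hend] at hxy
  cases hi : y.2.1 <;> rw [hi] at hxy
  exacts [hxy.symm, hxy]

theorem arc_eq_acrossEnd_of_not_isLoop (he : e ∈ G.edges) (hloop : ¬ G.IsLoop e)
    (hx : x.1 = e) (hax : (G.arc x).1 = e) : G.arc x = x.acrossEnd :=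
  (eq_or_eq_acrossEnd_of_not_isLoop he hloop hx hax (G.cls_arc x).symm).resolve_left
    (G.arc_ne (hx ▸ he))

/-- Going around the vertex-disc from one corner of an end of `e`, one first meets `e` again at the
other corner of that end, so the rest of the boundary circle already joins the two corners. -/
theorem cls_compl_acrossEnd_of_not_isLoop (he : e ∈ G.edges) (hloop : ¬ G.IsLoop e)
    (hx : x.1 = e) : G.cls {e}ᶜ ∅ x.acrossEnd = G.cls {e}ᶜ ∅ x := by
  classical
  have hxG : x.1 ∈ G.edges := hx ▸ he
  have hreturn : ∃ k, (G.next^[k + 1] x).1 = e :=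
    ⟨Function.minimalPeriod G.next x - 1, by
      rw [Nat.sub_add_cancel (G.minimalPeriod_next_pos hxG), Function.iterate_minimalPeriod, hx]⟩
  have hwalk : ∀ k ≤ Nat.find hreturn,
      G.cls {e}ᶜ ∅ (G.next^[k + 1] x) = G.cls {e}ᶜ ∅ x.acrossEnd := by
    intro k hk
    induction k with
    | zero => exact G.cls_arc _
    | succ k ih =>
      rw [Function.iterate_succ_apply', next, G.cls_arc,
        G.cls_acrossEnd (G.iterate_next_mem hxG _) (Nat.find_min hreturn hk), ih (by omega)]
  have hfirst : G.next^[Nat.find hreturn + 1] x = x :=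
    (eq_or_eq_acrossEnd_of_not_isLoop he hloop hx (Nat.find_spec hreturn)
      (G.cls_univ_iterate_next hxG _).symm).resolve_right (G.iterate_next_ne_acrossEnd hxG _)
  rw [← hwalk _ le_rfl, hfirst]

theorem numClasses_compl_of_not_isLoop (he : e ∈ G.edges) (hloop : ¬ G.IsLoop e) (T : Set α) :
    G.numClasses {e}ᶜ T = G.numClasses Set.univ T := by
  refine congrArg (· + _) (ncard_image_congr G.finite_corners fun x _ y _ =>
    ⟨cls_mono (Set.subset_univ _) subset_rfl, ?_⟩)
  refine apply_eq_of_cls_eq _ (fun z _ => G.cls_arc z) (fun z hz _ => ?_)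
    (fun z hz hzT => G.cls_alongSide hz hzT)
  by_cases hze : z.1 = e
  · exact cls_mono subset_rfl (Set.empty_subset T)
      (cls_compl_acrossEnd_of_not_isLoop he hloop hze)
  · exact G.cls_acrossEnd hz hze

end NonLoop

section IsolatedEdge

variable {G : RibbonGraph α} {e : α} {S T : Set α} {x : Corner α}

/-- Each end of `e` is the only end on its vertex-disc; this is the case in which contracting `e`
creates a vertex-disc that meets no ribbon. -/
def IsIsolatedEdge (G : RibbonGraph α) (e : α) : Prop :=
  ∀ i s : Bool, G.arc (e, i, s) = Corner.acrossEnd (e, i, s)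

theorem IsIsolatedEdge.arc_eq (h : G.IsIsolatedEdge e) (hx : x.1 = e) :
    G.arc x = x.acrossEnd := by
  obtain ⟨f, i, s⟩ := x
  obtain rfl : f = e := hx
  exact h i s

theorem IsIsolatedEdge.arc_fst_eq_iff (h : G.IsIsolatedEdge e) : (G.arc x).1 = e ↔ x.1 = e := by
  refine ⟨fun hax => ?_, fun hx => by rw [h.arc_eq hx, Corner.acrossEnd_fst, hx]⟩
  rw [← G.arc_arc x, h.arc_eq hax, Corner.acrossEnd_fst, hax]

theorem isIsolatedEdge_of_arc_eq (hx : x.1 = e) (hax : G.arc x = x.acrossEnd)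
    (has : G.arc x.alongSide = x.alongSide.acrossEnd) : G.IsIsolatedEdge e := by
  have across {z} (hz : G.arc z = Corner.acrossEnd z) :
      G.arc z.acrossEnd = z.acrossEnd.acrossEnd := by
    rw [← hz, G.arc_arc, hz, Corner.acrossEnd_acrossEnd]
  have hax' := across hax
  have has' := across has
  obtain ⟨f, i, s⟩ := x
  obtain rfl : f = e := hx
  intro j t
  cases i <;> cases s <;> cases j <;> cases t <;> first
    | exact hax
    | exact hax'
    | exact has
    | exact has'

theorem IsIsolatedEdge.cls_eq (hiso : G.IsIsolatedEdge e) (he : e ∈ G.edges) (heT : e ∈ T)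
    (hx : x.1 = e) : G.cls S T x = G.cls S T (e, false, false) := by
  obtain ⟨f, i, s⟩ := x
  obtain rfl : f = e := hx
  have hend (i : Bool) : G.cls S T (f, i, true) = G.cls S T (f, i, false) := by
    rw [← G.cls_arc, hiso]
    rfl
  have hside : G.cls S T (f, true, false) = G.cls S T (f, false, false) :=
    G.cls_alongSide (x := (f, false, false)) he heT
  cases i <;> cases s <;> simp only [hend, hside]

end IsolatedEdge

section Contract

variable [DecidableEq α] {G : RibbonGraph α} {e : α} {S T : Set α} {x y : Corner α}

theorem mem_contract_edges {f : α} : f ∈ (G.contract e).edges ↔ f ≠ e ∧ f ∈ G.edges :=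
  Finset.mem_erase

theorem contractArc_of_ne (hx : x.1 ≠ e) :
    G.contractArc e x = G.passThrough e (G.passThrough e (G.arc x)) := if_neg hx

theorem cls_passThrough (he : e ∈ G.edges) (heT : e ∈ T) (y : Corner α) :
    G.cls S T (G.passThrough e y) = G.cls S T y := by
  by_cases hy : y.1 = e
  · rw [G.passThrough_of_eq hy, G.cls_arc, G.cls_alongSide (hy ▸ he) (hy ▸ heT)]
  · rw [G.passThrough_of_ne hy]

theorem cls_contractArc (he : e ∈ G.edges) (heT : e ∈ T) (x : Corner α) :
    G.cls S T (G.contractArc e x) = G.cls S T x := by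
  by_cases hx : x.1 = e
  · exact congrArg _ (if_pos hx)
  · rw [contractArc_of_ne hx, cls_passThrough he heT, cls_passThrough he heT, G.cls_arc]

theorem cls_eq_of_cls_contract_eq (he : e ∈ G.edges) (heT : e ∈ T)
    (h : (G.contract e).cls S T x = (G.contract e).cls S T y) : G.cls S T x = G.cls S T y :=
  apply_eq_of_cls_eq _ (fun z _ => cls_contractArc he heT z)
    (fun _ hz hzS => G.cls_acrossEnd (mem_contract_edges.1 hz).2 hzS)
    (fun _ hz hzT => G.cls_alongSide (mem_contract_edges.1 hz).2 hzT) h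

/-- For a corner `x` of `e`, the first corner off `e` met when following the boundary of `e` and its
two vertex-discs from the arc at `x`; corners off `e` are fixed. -/
def exit (G : RibbonGraph α) (e : α) (x : Corner α) : Corner α :=
  if x.1 = e then G.passThrough e (G.arc x) else x

theorem exit_of_ne (hx : x.1 ≠ e) : G.exit e x = x := if_neg hx

theorem exit_of_arc_ne (hx : x.1 = e) (hax : (G.arc x).1 ≠ e) : G.exit e x = G.arc x :=
  (if_pos hx).trans (G.passThrough_of_ne hax)

theorem exit_of_arc_eq (hx : x.1 = e) (hax : (G.arc x).1 = e) :
    G.exit e x = G.arc (G.arc x).alongSide :=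
  (if_pos hx).trans (G.passThrough_of_eq hax)

theorem cls_exit (he : e ∈ G.edges) (heT : e ∈ T) (x : Corner α) :
    G.cls S T (G.exit e x) = G.cls S T x := by
  unfold exit
  split_ifs
  · rw [cls_passThrough he heT, G.cls_arc]
  · rfl

theorem exit_mem_contract_edges (he : e ∈ G.edges) (hloop : ¬ G.IsLoop e)
    (hiso : ¬ G.IsIsolatedEdge e) (hx : x.1 ∈ G.edges) :
    (G.exit e x).1 ∈ (G.contract e).edges := by
  refine mem_contract_edges.2 ?_
  by_cases hxe : x.1 = e
  · by_cases hax : (G.arc x).1 = e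
    · rw [exit_of_arc_eq hxe hax]
      refine ⟨fun has => hiso ?_, G.arc_mem (x := (G.arc x).alongSide) (hax ▸ he)⟩
      exact isIsolatedEdge_of_arc_eq hax (arc_eq_acrossEnd_of_not_isLoop he hloop hax
        (by rw [G.arc_arc, hxe])) (arc_eq_acrossEnd_of_not_isLoop he hloop hax has)
    · rw [exit_of_arc_ne hxe hax]
      exact ⟨hax, G.arc_mem hx⟩
  · rw [exit_of_ne hxe]
    exact ⟨hxe, hx⟩

theorem contractArc_exit (he : e ∈ G.edges) (hloop : ¬ G.IsLoop e) (hiso : ¬ G.IsIsolatedEdge e)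
    (hx : x.1 = e) : G.contractArc e (G.exit e x) = G.exit e x.alongSide := by
  have hexit : (G.exit e x).1 ≠ e :=
    (mem_contract_edges.1 (exit_mem_contract_edges he hloop hiso (hx ▸ he))).1
  have hside : G.passThrough e (G.arc x.alongSide) = G.exit e x.alongSide := (if_pos hx).symm
  by_cases hax : (G.arc x).1 = e
  · have hacross := arc_eq_acrossEnd_of_not_isLoop he hloop hx hax
    have has : (G.arc x.alongSide).1 ≠ e := fun has => hiso (isIsolatedEdge_of_arc_eq hx hacross
      (arc_eq_acrossEnd_of_not_isLoop he hloop hx has))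
    rw [contractArc_of_ne hexit, exit_of_arc_eq hx hax, G.arc_arc,
      exit_of_arc_ne (x := x.alongSide) hx has,
      G.passThrough_of_eq (y := (G.arc x).alongSide) hax, Corner.alongSide_alongSide, G.arc_arc,
      G.passThrough_of_eq hx]
  · rw [contractArc_of_ne hexit, exit_of_arc_ne hx hax, G.arc_arc, G.passThrough_of_eq hx, hside]

theorem cls_contract_exit_alongSide (he : e ∈ G.edges) (hloop : ¬ G.IsLoop e)
    (hiso : ¬ G.IsIsolatedEdge e) (hx : x.1 = e) :
    (G.contract e).cls S T (G.exit e x.alongSide) = (G.contract e).cls S T (G.exit e x) := by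
  rw [← contractArc_exit he hloop hiso hx]
  exact (G.contract e).cls_arc _

theorem cls_contract_exit_arc (he : e ∈ G.edges) (hloop : ¬ G.IsLoop e)
    (hiso : ¬ G.IsIsolatedEdge e) (hx : x.1 = e) :
    (G.contract e).cls S T (G.exit e (G.arc x)) = (G.contract e).cls S T (G.exit e x) := by
  by_cases hax : (G.arc x).1 = e
  · have has : (G.arc x.alongSide).1 ≠ e := fun has => hiso (isIsolatedEdge_of_arc_eq hx
      (arc_eq_acrossEnd_of_not_isLoop he hloop hx hax)
      (arc_eq_acrossEnd_of_not_isLoop he hloop hx has))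
    rw [← cls_contract_exit_alongSide he hloop hiso hx,
      exit_of_arc_ne (x := x.alongSide) hx has,
      exit_of_arc_eq hax (by rw [G.arc_arc, hx]), G.arc_arc]
  · rw [exit_of_arc_ne hx hax, exit_of_ne hax]

theorem cls_contract_exit_eq_of_cls_eq (he : e ∈ G.edges) (hloop : ¬ G.IsLoop e)
    (hiso : ¬ G.IsIsolatedEdge e) (heS : e ∉ S) (h : G.cls S T x = G.cls S T y) :
    (G.contract e).cls S T (G.exit e x) = (G.contract e).cls S T (G.exit e y) := by
  refine apply_eq_of_cls_eq (fun z => (G.contract e).cls S T (G.exit e z)) (fun z _ => ?_)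
    (fun z hz hzS => ?_) (fun z hz hzT => ?_) h
  · by_cases hze : z.1 = e
    · exact cls_contract_exit_arc he hloop hiso hze
    · by_cases haz : (G.arc z).1 = e
      · rw [← cls_contract_exit_arc he hloop hiso haz, G.arc_arc]
      · rw [exit_of_ne hze, exit_of_ne haz, ← (G.contract e).cls_arc z]
        refine congrArg _ (Eq.symm ?_)
        exact (contractArc_of_ne hze).trans
          (by rw [G.passThrough_of_ne haz, G.passThrough_of_ne haz])
  · have hze : z.1 ≠ e := fun hze => heS (hze ▸ hzS)
    rw [exit_of_ne hze, exit_of_ne (x := z.acrossEnd) hze]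
    exact (G.contract e).cls_acrossEnd (mem_contract_edges.2 ⟨hze, hz⟩) hzS
  · by_cases hze : z.1 = e
    · exact cls_contract_exit_alongSide he hloop hiso hze
    · rw [exit_of_ne hze, exit_of_ne (x := z.alongSide) hze]
      exact (G.contract e).cls_alongSide (mem_contract_edges.2 ⟨hze, hz⟩) hzT

theorem numClasses_contract_of_not_isIsolatedEdge (he : e ∈ G.edges) (hloop : ¬ G.IsLoop e)
    (hiso : ¬ G.IsIsolatedEdge e) (heS : e ∉ S) (heT : e ∈ T) :
    (G.contract e).numClasses S T = G.numClasses S T := by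
  have himage : G.cls S T '' G.corners = G.cls S T '' (G.contract e).corners := by
    refine Set.Subset.antisymm ?_ (Set.image_mono fun x hx => (mem_contract_edges.1 hx).2)
    rintro _ ⟨x, hx, rfl⟩
    exact ⟨G.exit e x, exit_mem_contract_edges he hloop hiso hx, cls_exit he heT x⟩
  have hisolated : (G.contract e).isolated = G.isolated :=
    congrArg (G.isolated + ·) (if_neg hiso)
  rw [numClasses, numClasses, himage, hisolated]
  refine congrArg (· + _) (ncard_image_congr (G.contract e).finite_corners fun x hx y hy =>
    ⟨cls_eq_of_cls_contract_eq he heT, fun h => ?_⟩)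
  have hexit := cls_contract_exit_eq_of_cls_eq he hloop hiso heS h
  rwa [exit_of_ne (mem_contract_edges.1 hx).1, exit_of_ne (mem_contract_edges.1 hy).1] at hexit

theorem IsIsolatedEdge.cls_contract_eq_of_cls_eq (hiso : G.IsIsolatedEdge e)
    (h : G.cls S T x = G.cls S T y) :
    (if x.1 = e then none else some ((G.contract e).cls S T x)) =
      if y.1 = e then none else some ((G.contract e).cls S T y) := by
  refine apply_eq_of_cls_eq
    (fun z => if z.1 = e then none else some ((G.contract e).cls S T z)) (fun z _ => ?_)
    (fun z hz hzS => ?_) (fun z hz hzT => ?_) h <;> by_cases hze : z.1 = e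
  · simp only [hiso.arc_fst_eq_iff, hze, if_pos]
  · have haz : (G.arc z).1 ≠ e := mt hiso.arc_fst_eq_iff.1 hze
    have harc : (G.contract e).arc z = G.arc z := (contractArc_of_ne hze).trans
      (by rw [G.passThrough_of_ne haz, G.passThrough_of_ne haz])
    simp only [hze, haz, if_false]
    rw [← harc, cls_arc]
  · simp only [Corner.acrossEnd_fst, hze, if_pos]
  · simp only [Corner.acrossEnd_fst, hze, if_false,
      (G.contract e).cls_acrossEnd (mem_contract_edges.2 ⟨hze, hz⟩) hzS]
  · simp only [Corner.alongSide_fst, hze, if_pos]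
  · simp only [Corner.alongSide_fst, hze, if_false,
      (G.contract e).cls_alongSide (mem_contract_edges.2 ⟨hze, hz⟩) hzT]

theorem IsIsolatedEdge.numClasses_contract (hiso : G.IsIsolatedEdge e) (he : e ∈ G.edges)
    (heT : e ∈ T) : (G.contract e).numClasses S T = G.numClasses S T := by
  have hcorners : G.cls S T '' G.corners =
      insert (G.cls S T (e, false, false)) (G.cls S T '' (G.contract e).corners) := by
    ext q
    constructor
    · rintro ⟨x, hx, rfl⟩
      by_cases hxe : x.1 = e
      · exact Or.inl (hiso.cls_eq he heT hxe)
      · exact Or.inr ⟨x, mem_contract_edges.2 ⟨hxe, hx⟩, rfl⟩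
    · rintro (rfl | ⟨x, hx, rfl⟩)
      exacts [⟨_, he, rfl⟩, ⟨x, (mem_contract_edges.1 hx).2, rfl⟩]
  have hnew : G.cls S T (e, false, false) ∉ G.cls S T '' (G.contract e).corners := by
    rintro ⟨x, hx, hxe⟩
    simpa [(mem_contract_edges.1 hx).1] using hiso.cls_contract_eq_of_cls_eq hxe
  have hisolated : (G.contract e).isolated = G.isolated + 1 :=
    congrArg (G.isolated + ·) (if_pos hiso)
  have hcongr : ((G.contract e).cls S T '' (G.contract e).corners).ncard =
      (G.cls S T '' (G.contract e).corners).ncard :=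
    ncard_image_congr (G.contract e).finite_corners fun x hx y hy =>
      ⟨cls_eq_of_cls_contract_eq he heT, fun h => by
        simpa [(mem_contract_edges.1 hx).1, (mem_contract_edges.1 hy).1] using
          hiso.cls_contract_eq_of_cls_eq h⟩
  rw [numClasses, numClasses, hcorners, Set.ncard_insert_of_notMem hnew
    ((G.contract e).finite_corners.image _), hisolated, hcongr]
  ring

theorem numClasses_contract (he : e ∈ G.edges) (hloop : ¬ G.IsLoop e) (heS : e ∉ S)
    (heT : e ∈ T) : (G.contract e).numClasses S T = G.numClasses S T := by
  by_cases hiso : G.IsIsolatedEdge e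
  · exact hiso.numClasses_contract he heT
  · exact numClasses_contract_of_not_isIsolatedEdge he hloop hiso heS heT

theorem numClasses_univ_contract (he : e ∈ G.edges) (hloop : ¬ G.IsLoop e) (heT : e ∈ T) :
    (G.contract e).numClasses Set.univ T = G.numClasses Set.univ T := by
  have hends : (G.contract e).numClasses Set.univ T = (G.contract e).numClasses {e}ᶜ T :=
    (G.contract e).numClasses_congr (fun f hf => by simp [(mem_contract_edges.1 hf).1])
      fun _ _ => Iff.rfl
  rw [hends, numClasses_contract he hloop (by simp) heT, numClasses_compl_of_not_isLoop he hloop]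

theorem numClasses_contract_insert (e : α) (S T : Set α) :
    (G.contract e).numClasses S (insert e T) = (G.contract e).numClasses S T :=
  (G.contract e).numClasses_congr (fun _ _ => Iff.rfl) fun f hf => by
    simp [(mem_contract_edges.1 hf).1]

theorem numVertices_contract_add_one (he : e ∈ G.edges) (hloop : ¬ G.IsLoop e) :
    (G.contract e).numVertices + 1 = G.numVertices := by
  rw [numVertices_eq_numClasses, ← numClasses_contract_insert,
    numClasses_univ_contract he hloop (Set.mem_insert e ∅),
    G.numClasses_univ_insert_add_one he hloop, numVertices_eq_numClasses]

theorem numFaces_contract (he : e ∈ G.edges) (hloop : ¬ G.IsLoop e) :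
    (G.contract e).numFaces = G.numFaces := by
  rw [numFaces_eq_numClasses, numFaces_eq_numClasses,
    numClasses_contract he hloop (Set.notMem_empty e) (Set.mem_univ e)]

theorem numComponents_contract (he : e ∈ G.edges) (hloop : ¬ G.IsLoop e) :
    (G.contract e).numComponents = G.numComponents := by
  rw [numComponents_eq_numClasses, numComponents_eq_numClasses,
    numClasses_univ_contract he hloop (Set.mem_univ e)]

theorem eulerGenus_contract (he : e ∈ G.edges) (hloop : ¬ G.IsLoop e) :
    (G.contract e).eulerGenus = G.eulerGenus := by
  have hV := numVertices_contract_add_one he hloop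
  have hE : (G.contract e).edges.card + 1 = G.edges.card := Finset.card_erase_add_one he
  rw [eulerGenus, eulerGenus, eulerChar, eulerChar, numComponents_contract he hloop,
    numFaces_contract he hloop, ← hV, ← hE]
  push_cast
  ring

end Contract

section Petrial

variable [DecidableEq α] (G : RibbonGraph α) (A : Finset α) {x y : Corner α}

theorem arc_petrial (x : Corner α) :
    (G.petrial A).arc x = Corner.swapOn A (G.arc (Corner.swapOn A x)) := rfl

theorem petrial_petrial_self : (G.petrial A).petrial A = G := by
  obtain ⟨edges, arc, _, _, isolated⟩ := G
  simp only [petrial, Corner.swapOn_swapOn]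

variable {A} in
theorem petrial_petrial {B : Finset α} (h : Disjoint A B) :
    (G.petrial A).petrial B = G.petrial (A ∪ B) := by
  simp only [petrial, Corner.swapOn_union h, mk.injEq, true_and, and_true]
  funext x
  rw [← Corner.swapOn_union h.symm, Finset.union_comm, Corner.swapOn_union h]

theorem cls_univ_swapOn {T : Set α} (hx : x.1 ∈ G.edges) :
    G.cls Set.univ T (Corner.swapOn A x) = G.cls Set.univ T x := by
  obtain h | h := Corner.swapOn_eq_or A x <;> rw [h]
  exact G.cls_acrossEnd hx (Set.mem_univ _)

variable {G A} in
theorem cls_univ_eq_of_cls_petrial_eq {T : Set α}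
    (h : (G.petrial A).cls Set.univ T x = (G.petrial A).cls Set.univ T y) :
    G.cls Set.univ T x = G.cls Set.univ T y := by
  refine apply_eq_of_cls_eq (G := G.petrial A) (G.cls Set.univ T) (fun z hz => ?_)
    (fun z hz _ => G.cls_acrossEnd hz (Set.mem_univ _)) (fun z hz hzT => G.cls_alongSide hz hzT) h
  have hswap : (Corner.swapOn A z).1 ∈ G.edges := (Corner.swapOn_fst A z).symm ▸ hz
  rw [arc_petrial, cls_univ_swapOn G A (G.arc_mem hswap), G.cls_arc, cls_univ_swapOn G A hz]

theorem numClasses_univ_petrial (T : Set α) :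
    (G.petrial A).numClasses Set.univ T = G.numClasses Set.univ T :=
  congrArg (· + _) (ncard_image_congr G.finite_corners fun x _ y _ =>
    ⟨cls_univ_eq_of_cls_petrial_eq, fun h => cls_univ_eq_of_cls_petrial_eq (A := A)
      (by rwa [petrial_petrial_self])⟩)

theorem numVertices_petrial : (G.petrial A).numVertices = G.numVertices := by
  simp only [numVertices_eq_numClasses, numClasses_univ_petrial]

theorem numComponents_petrial : (G.petrial A).numComponents = G.numComponents := by
  simp only [numComponents_eq_numClasses, numClasses_univ_petrial]

variable {A} {e : α}

theorem passThrough_petrial (he : e ∉ A) (y : Corner α) :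
    (G.petrial A).passThrough e (Corner.swapOn A y) = Corner.swapOn A (G.passThrough e y) := by
  by_cases hy : y.1 = e
  · have hyA : y.1 ∉ A := hy ▸ he
    rw [passThrough_of_eq _ ((Corner.swapOn_fst A y).trans hy), passThrough_of_eq _ hy,
      Corner.swapOn_of_notMem hyA, arc_petrial, Corner.swapOn_of_notMem (x := y.alongSide) hyA]
  · rw [passThrough_of_ne _ hy, passThrough_of_ne _ (by rwa [Corner.swapOn_fst])]

theorem contractArc_petrial (he : e ∉ A) (x : Corner α) :
    (G.petrial A).contractArc e x = Corner.swapOn A (G.contractArc e (Corner.swapOn A x)) := by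
  by_cases hx : x.1 = e
  · simp only [contractArc, hx, Corner.swapOn_fst, if_true, Corner.swapOn_swapOn]
  · rw [contractArc_of_ne hx, contractArc_of_ne ((Corner.swapOn_fst A x).trans_ne hx), arc_petrial,
      passThrough_petrial G he, passThrough_petrial G he]

theorem isIsolatedEdge_petrial (he : e ∉ A) :
    (G.petrial A).IsIsolatedEdge e ↔ G.IsIsolatedEdge e := by
  refine forall_congr' fun i => forall_congr' fun s => ?_
  rw [arc_petrial, Corner.swapOn_of_notMem (x := (e, i, s)) he]
  conv_lhs => rw [← Corner.swapOn_of_notMem (x := Corner.acrossEnd (e, i, s)) he]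
  exact (Function.LeftInverse.injective (Corner.swapOn_swapOn A)).eq_iff

theorem contract_petrial (he : e ∉ A) :
    (G.petrial A).contract e = (G.contract e).petrial A := by
  have harc : (G.petrial A).contractArc e =
      fun x => Corner.swapOn A (G.contractArc e (Corner.swapOn A x)) :=
    funext (contractArc_petrial G he)
  have hisolated : ((G.petrial A).contract e).isolated = (G.contract e).isolated :=
    congrArg (G.isolated + ·) (if_congr (isIsolatedEdge_petrial G he) rfl rfl)
  simp only [contract, petrial, mk.injEq, true_and]
  exact ⟨harc, hisolated⟩

theorem aux_petrial (l : List α) (hl : ∀ e ∈ l, e ∉ A) :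
    (G.petrial A).aux l = (G.aux l).petrial A := by
  induction l generalizing G with
  | nil => rfl
  | cons e l ih =>
    obtain ⟨he, hl⟩ := List.forall_mem_cons.1 hl
    exact (congrArg (aux · l) (G.contract_petrial he)).trans (ih (G.contract e) hl)

theorem edges_aux (l : List α) : (G.aux l).edges = G.edges \ l.toFinset := by
  induction l generalizing G with
  | nil => exact Finset.sdiff_empty.symm
  | cons e l ih =>
    rw [List.toFinset_cons, Finset.sdiff_insert, ← Finset.erase_sdiff_comm]
    exact ih (G.contract e)

end Petrial

section Forest

variable {G : RibbonGraph α} {T : Finset α}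

/-- The ribbons in `T` contain no cycle: adding them one by one always joins two different classes
of vertex-discs. -/
structure IsForest (G : RibbonGraph α) (T : Finset α) : Prop where
  subset : T ⊆ G.edges
  numVertices_eq : G.numVertices = G.numClasses Set.univ T + T.card

/-- A forest that links the vertex-discs of each connected component of `G`; the counterpart of a
spanning tree when `G` need not be connected. -/
structure IsSpanningForest (G : RibbonGraph α) (T : Finset α) : Prop extends IsForest G T where
  numClasses_eq : G.numClasses Set.univ T = G.numComponents

variable {e : α}

theorem IsForest.not_isLoop (h : G.IsForest T) (he : e ∈ T) : ¬ G.IsLoop e := fun hloop => by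
  classical
  have hcls : G.numClasses Set.univ T = G.numClasses Set.univ (T.erase e) := by
    rw [← G.numClasses_univ_insert_of_cls_eq (T := (T.erase e : Finset α)) (h.subset he)
      (cls_mono subset_rfl (Set.empty_subset _) hloop), ← Finset.coe_insert, Finset.insert_erase he]
  have hle := G.numClasses_univ_empty_le_add_card (T.erase e)
    ((Finset.erase_subset _ _).trans h.subset)
  have hcard := Finset.card_erase_add_one he
  rw [← numVertices_eq_numClasses, h.numVertices_eq, hcls] at hle
  omega

theorem IsSpanningForest.card_eq (h : G.IsSpanningForest T) :
    T.card = G.numVertices - G.numComponents := by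
  rw [h.numVertices_eq, h.numClasses_eq, Nat.add_sub_cancel_left]

variable [DecidableEq α]

theorem IsForest.petrial (h : G.IsForest T) (A : Finset α) : (G.petrial A).IsForest T where
  subset := h.subset
  numVertices_eq := by rw [numVertices_petrial, numClasses_univ_petrial, h.numVertices_eq]

theorem numClasses_contract_erase_of_isForest (h : G.IsForest T) (he : e ∈ T) :
    (G.contract e).numClasses Set.univ (T.erase e) = G.numClasses Set.univ T := by
  rw [← numClasses_contract_insert, ← Finset.coe_insert, Finset.insert_erase he,
    numClasses_univ_contract (h.subset he) (h.not_isLoop he) he]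

theorem IsForest.contract (h : G.IsForest T) (he : e ∈ T) :
    (G.contract e).IsForest (T.erase e) where
  subset := Finset.erase_subset_erase e h.subset
  numVertices_eq := by
    have hV := numVertices_contract_add_one (h.subset he) (h.not_isLoop he)
    have hcard := Finset.card_erase_add_one he
    have hT := h.numVertices_eq
    rw [numClasses_contract_erase_of_isForest h he]
    omega

variable {l : List α}

theorem IsForest.apply_aux_eq {M : Type*} (f : RibbonGraph α → M)
    (hf : ∀ (G : RibbonGraph α) (e : α), e ∈ G.edges → ¬ G.IsLoop e → f (G.contract e) = f G)
    (hl : l.Nodup) (h : G.IsForest l.toFinset) : f (G.aux l) = f G := by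
  induction l generalizing G with
  | nil => rfl
  | cons e l ih =>
    obtain ⟨hel, hl⟩ := List.nodup_cons.1 hl
    have he : e ∈ (e :: l).toFinset := List.mem_toFinset.2 List.mem_cons_self
    have hcontract := h.contract he
    rw [List.toFinset_cons, Finset.erase_insert (mt List.mem_toFinset.1 hel)] at hcontract
    exact (ih hl hcontract).trans (hf G e (h.subset he) (h.not_isLoop he))

theorem IsForest.numComponents_aux (hl : l.Nodup) (h : G.IsForest l.toFinset) :
    (G.aux l).numComponents = G.numComponents :=
  h.apply_aux_eq numComponents (fun _ _ => numComponents_contract) hl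

theorem IsForest.eulerGenus_aux (hl : l.Nodup) (h : G.IsForest l.toFinset) :
    (G.aux l).eulerGenus = G.eulerGenus :=
  h.apply_aux_eq eulerGenus (fun _ _ => eulerGenus_contract) hl

theorem IsForest.numVertices_aux (hl : l.Nodup) (h : G.IsForest l.toFinset) :
    (G.aux l).numVertices = G.numClasses Set.univ l.toFinset := by
  have hsub : (l.toFinset).card ≤ G.edges.card := Finset.card_le_card h.subset
  have hinv : (((G.aux l).numVertices : ℤ) - (G.aux l).edges.card) =
      G.numVertices - G.edges.card := by
    refine h.apply_aux_eq (fun G => (G.numVertices - G.edges.card : ℤ)) (fun G e he hloop => ?_) hl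
    have hV := numVertices_contract_add_one he hloop
    have hE : (G.contract e).edges.card + 1 = G.edges.card := Finset.card_erase_add_one he
    omega
  have hE := Finset.card_sdiff_of_subset h.subset
  rw [edges_aux] at hinv
  have hT := h.numVertices_eq
  omega

theorem IsForest.petrialPoly_eq_sum_aux (hl : l.Nodup) (h : G.IsForest l.toFinset) :
    G.petrialPoly = ∑ X ∈ l.toFinset.powerset, ((G.petrial X).aux l).petrialPoly := by
  rw [petrialPoly, sum_powerset_eq_sum_powerset_sdiff h.subset]
  refine Finset.sum_congr rfl fun X hX => ?_
  rw [petrialPoly, edges_aux]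
  refine Finset.sum_congr rfl fun Y hY => ?_
  have hYT : Disjoint l.toFinset Y :=
    (Finset.sdiff_disjoint.mono_left (Finset.mem_powerset.1 hY)).symm
  have hYl : ∀ e ∈ l, e ∉ Y := fun e he => Finset.disjoint_left.1 hYT (List.mem_toFinset.2 he)
  rw [← aux_petrial _ l hYl, petrial_petrial _ (hYT.mono_left (Finset.mem_powerset.1 hX)),
    (h.petrial _).eulerGenus_aux hl]

theorem IsSpanningForest.petrial (h : G.IsSpanningForest T) (A : Finset α) :
    (G.petrial A).IsSpanningForest T where
  toIsForest := h.toIsForest.petrial A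
  numClasses_eq := by rw [numClasses_univ_petrial, numComponents_petrial, h.numClasses_eq]

theorem IsSpanningForest.numVertices_aux (hl : l.Nodup) (h : G.IsSpanningForest l.toFinset) :
    (G.aux l).numVertices = G.numComponents :=
  (h.toIsForest.numVertices_aux hl).trans h.numClasses_eq

end Forest

section SpanningTree

variable {G : RibbonGraph α} {T : Finset α}

instance (G : RibbonGraph α) : Finite G.Vertex :=
  inferInstanceAs (Finite (Quot _ ⊕ Fin G.isolated))

theorem IsSpanningTree.numVertices_eq (hT : G.IsSpanningTree T) :
    G.numVertices = T.card + 1 := by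
  classical
  have := Fintype.ofFinite G.Vertex
  rw [numVertices, Nat.card_eq_fintype_card, ← hT.isTree.card_edgeFinset]
  refine congrArg (· + 1) (Eq.symm ?_)
  refine Finset.card_bij (fun e he => G.ends ⟨e, hT.subset he⟩) ?_ ?_ ?_
  · intro e he
    rw [SimpleGraph.mem_edgeFinset, SimpleGraph.edgeSet_fromEdgeSet]
    exact ⟨⟨_, he, rfl⟩, hT.not_loop _ he⟩
  · intro e he f hf h
    exact congrArg Subtype.val (hT.not_parallel _ _ he hf h)
  · intro p hp
    rw [SimpleGraph.mem_edgeFinset, SimpleGraph.edgeSet_fromEdgeSet] at hp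
    obtain ⟨⟨e, he, rfl⟩, -⟩ := hp
    exact ⟨e.1, he, rfl⟩

/-- The class, after linking along `T`, of a vertex-disc of `G`. -/
def vertexClass (G : RibbonGraph α) (T : Set α) :
    G.Vertex → (Quot fun x y : G.Corners => G.link Set.univ T x y) ⊕ Fin G.isolated :=
  Sum.map (Quot.map id fun x _ h => ⟨x.2, h.imp_right fun h => Or.inl ⟨Set.mem_univ _, h⟩⟩) id

theorem surjective_vertexClass (T : Set α) : Function.Surjective (G.vertexClass T) := by
  rintro (⟨⟨x⟩⟩ | i)
  exacts [⟨Sum.inl (Quot.mk _ x), rfl⟩, ⟨Sum.inr i, rfl⟩]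

theorem vertexClass_endVertex {T : Set α} (e : G.edges) (he : e.1 ∈ T) :
    G.vertexClass T (G.endVertex e false) = G.vertexClass T (G.endVertex e true) :=
  congrArg Sum.inl (Quot.sound ⟨e.2, Or.inr (Or.inr ⟨he, rfl⟩)⟩)

theorem IsSpanningTree.vertexClass_eq (hT : G.IsSpanningTree T) (u v : G.Vertex) :
    G.vertexClass T u = G.vertexClass T v := by
  obtain ⟨w⟩ := hT.isTree.connected.preconnected u v
  induction w with
  | nil => rfl
  | cons hadj _ ih =>
    refine Eq.trans ?_ ih
    obtain ⟨⟨e, he, hends⟩, -⟩ := (SimpleGraph.fromEdgeSet_adj _).1 hadj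
    obtain ⟨rfl, rfl⟩ | ⟨rfl, rfl⟩ := Sym2.eq_iff.1 hends
    exacts [vertexClass_endVertex e he, (vertexClass_endVertex e he).symm]

theorem IsSpanningTree.numClasses_eq_one (hT : G.IsSpanningTree T) :
    G.numClasses Set.univ T = 1 := by
  rw [numClasses, ← natCard_quot_corners, ← Nat.card_fin G.isolated, ← Nat.card_sum,
    Nat.card_eq_one_iff_unique]
  have hne : Nonempty G.Vertex := hT.isTree.connected.nonempty
  refine ⟨⟨(surjective_vertexClass _).forall₂.2 hT.vertexClass_eq⟩, hne.map (G.vertexClass T)⟩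

theorem IsSpanningTree.isSpanningForest (hT : G.IsSpanningTree T) (hG : G.Connected) :
    G.IsSpanningForest T where
  subset := hT.subset
  numVertices_eq := by rw [hT.numVertices_eq, hT.numClasses_eq_one, add_comm]
  numClasses_eq := hT.numClasses_eq_one.trans hG.symm

end SpanningTree

section Potential

variable {B : RibbonGraph α} {a b : α} {x : Corner α} {φ : Corner α → ZMod 2}

theorem isLoop_of_numVertices_eq (hB : B.numVertices = B.numComponents) (hb : b ∈ B.edges) :
    B.IsLoop b := by
  by_contra hloop
  have hmerge := B.numClasses_univ_insert_add_one (T := ∅) hb hloop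
  have hle := B.numClasses_anti (Set.Subset.refl Set.univ) (Set.subset_univ (insert b ∅))
  rw [numVertices_eq_numClasses, numComponents_eq_numClasses] at hB
  omega

theorem IsLoop.cls_eq (hloop : B.IsLoop b) (hb : b ∈ B.edges) {y : Corner α} (hx : x.1 = b)
    (hy : y.1 = b) : B.cls Set.univ ∅ x = B.cls Set.univ ∅ y := by
  have hcls {z : Corner α} (hz : z.1 = b) :
      B.cls Set.univ ∅ z = B.cls Set.univ ∅ (b, false, false) := by
    rw [B.cls_eq_of_end_eq (x := (b, z.2.1, false)) hb (Set.mem_univ b) hz.symm rfl]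
    cases z.2.1
    exacts [rfl, hloop.symm]
  rw [hcls hx, hcls hy]

theorem IsLoop.exists_iterate_next (hloop : B.IsLoop b) (hb : b ∈ B.edges) :
    ∃ q, 0 < q ∧ q < Function.minimalPeriod B.next (b, false, false) ∧
      (B.next^[q] (b, false, false)).1 = b ∧ (B.next^[q] (b, false, false)).2.1 = true := by
  obtain ⟨q, hq, h⟩ := B.exists_iterate_next_of_cls_eq hb hloop
  have hend : (B.next^[q] (b, false, false)).1 = b ∧
      (B.next^[q] (b, false, false)).2.1 = true := by
    rcases h with h | h
    · rw [← h]; exact ⟨rfl, rfl⟩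
    · rw [← Corner.acrossEnd_acrossEnd (B.next^[q] (b, false, false)), ← h]; exact ⟨rfl, rfl⟩
  refine ⟨q, Nat.pos_of_ne_zero ?_, hq, hend⟩
  rintro rfl
  exact Bool.false_ne_true hend.2

/-- The corners met when going around a vertex-disc from `x.acrossEnd` to the corner
`B.next^[q] x`. -/
def boundaryPath (B : RibbonGraph α) (x : Corner α) (q : ℕ) : Set (Corner α) :=
  {y | ∃ k < q, y = (B.next^[k] x).acrossEnd ∨ y = B.next^[k + 1] x}

theorem arc_mem_boundaryPath_iff {q : ℕ} {y : Corner α} :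
    B.arc y ∈ B.boundaryPath x q ↔ y ∈ B.boundaryPath x q := by
  have harc {y} : y ∈ B.boundaryPath x q → B.arc y ∈ B.boundaryPath x q := by
    rintro ⟨k, hk, rfl | rfl⟩
    · exact ⟨k, hk, Or.inr (B.arc_acrossEnd_iterate_next x k)⟩
    · exact ⟨k, hk, Or.inl (B.arc_iterate_next_succ x k)⟩
  exact ⟨fun h => B.arc_arc y ▸ harc h, harc⟩

theorem cls_eq_of_mem_boundaryPath (hx : x.1 ∈ B.edges) {q : ℕ} {y : Corner α}
    (hy : y ∈ B.boundaryPath x q) : B.cls Set.univ ∅ y = B.cls Set.univ ∅ x := by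
  obtain ⟨k, -, rfl | rfl⟩ := hy
  · rw [B.cls_acrossEnd (B.iterate_next_mem hx k) (Set.mem_univ _), B.cls_univ_iterate_next hx]
  · exact B.cls_univ_iterate_next hx _

theorem iterate_next_mem_boundaryPath_iff (hx : x.1 ∈ B.edges) {q t : ℕ}
    (hq : q < Function.minimalPeriod B.next x) (ht : t < Function.minimalPeriod B.next x) :
    B.next^[t] x ∈ B.boundaryPath x q ↔ 0 < t ∧ t ≤ q := by
  constructor
  · rintro ⟨k, hk, h | h⟩
    · exact absurd h (B.iterate_next_ne_acrossEnd_iterate hx _ _)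
    · have htk : t = k + 1 :=
        Function.iterate_injOn_Iio_minimalPeriod (f := B.next) ht (Set.mem_Iio.2 (by omega)) h
      omega
  · rintro ⟨ht0, htq⟩
    exact ⟨t - 1, by omega, Or.inr (by rw [Nat.sub_add_cancel ht0])⟩

theorem acrossEnd_iterate_next_mem_boundaryPath_iff (hx : x.1 ∈ B.edges) {q t : ℕ}
    (hq : q < Function.minimalPeriod B.next x) (ht : t < Function.minimalPeriod B.next x) :
    (B.next^[t] x).acrossEnd ∈ B.boundaryPath x q ↔ t < q := by
  constructor
  · rintro ⟨k, hk, h | h⟩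
    · have htk : t = k := Function.iterate_injOn_Iio_minimalPeriod (f := B.next) ht
        (Set.mem_Iio.2 (hk.trans hq)) (Corner.acrossEnd_inj.1 h)
      omega
    · exact absurd h.symm (B.iterate_next_ne_acrossEnd_iterate hx _ _)
  · exact fun h => ⟨t, h, Or.inl rfl⟩

theorem acrossEnd_mem_boundaryPath_iff_iff (hx : x.1 ∈ B.edges)
    (hloop : B.IsLoop x.1) {q : ℕ} (hq0 : 0 < q) (hq : q < Function.minimalPeriod B.next x)
    (hqx : (B.next^[q] x).1 = x.1) {y : Corner α} (hy : y.1 ∈ B.edges) :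
    (y.acrossEnd ∈ B.boundaryPath x q ↔ y ∈ B.boundaryPath x q) ↔ y.1 ≠ x.1 := by
  by_cases hxy : B.cls Set.univ ∅ x = B.cls Set.univ ∅ y
  · obtain ⟨t, ht, hty⟩ := B.exists_iterate_next_of_cls_eq hx hxy
    have hends : (B.next^[t] x).1 = x.1 ↔ t = 0 ∨ t = q := by
      refine ⟨fun h => ?_, by rintro (rfl | rfl); exacts [rfl, hqx]⟩
      by_contra! hne
      exact hne.2 (B.eq_of_iterate_next_fst_eq hx ht (B.minimalPeriod_next_pos hx) hq h hqx
        hne.1 hq0.ne')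
    have hmem := iterate_next_mem_boundaryPath_iff hx hq ht
    have hmem' := acrossEnd_iterate_next_mem_boundaryPath_iff hx hq ht
    obtain rfl | rfl := hty
    · rw [hmem, hmem', Ne, hends]; omega
    · rw [Corner.acrossEnd_acrossEnd, Corner.acrossEnd_fst, hmem, hmem', Ne, hends]; omega
  · have hy_notMem : y ∉ B.boundaryPath x q := fun h =>
      hxy (cls_eq_of_mem_boundaryPath hx h).symm
    have hy_notMem' : y.acrossEnd ∉ B.boundaryPath x q := fun h =>
      hxy ((B.cls_acrossEnd hy (Set.mem_univ _)).symm.trans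
        (cls_eq_of_mem_boundaryPath hx h)).symm
    refine iff_of_true (iff_of_false hy_notMem' hy_notMem) fun hyx => hxy ?_
    exact hloop.cls_eq hx rfl hyx

/-- A potential of the edge `b`: a `GF(2)`-valued function on the boundary of the vertex-discs that
is constant on arcs and jumps exactly at the ends of `b`. It counts modulo 2 the ends of `b` met
when going around a vertex-disc. -/
structure IsPotential [DecidableEq α] (B : RibbonGraph α) (b : α) (φ : Corner α → ZMod 2) :
    Prop where
  arc : ∀ x, φ (B.arc x) = φ x
  jump : ∀ x, x.1 ∈ B.edges → φ x.acrossEnd = φ x + if x.1 = b then 1 else 0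

variable [DecidableEq α]

open Classical in
theorem IsLoop.exists_isPotential (hloop : B.IsLoop b) (hb : b ∈ B.edges) :
    ∃ φ, B.IsPotential b φ := by
  obtain ⟨q, hq0, hq, hqb, -⟩ := hloop.exists_iterate_next hb
  let P := B.boundaryPath (b, false, false) q
  refine ⟨fun y => if y ∈ P then 1 else 0, fun y => if_congr arc_mem_boundaryPath_iff rfl rfl,
    fun y hy => ?_⟩
  have hcross : (y.acrossEnd ∈ P ↔ y ∈ P) ↔ y.1 ≠ b :=
    acrossEnd_mem_boundaryPath_iff_iff (x := (b, false, false)) hb hloop hq0 hq hqb hy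
  by_cases hyP : y ∈ P <;> by_cases hyP' : y.acrossEnd ∈ P <;> simp_all [CharTwo.add_self_eq_zero]

theorem IsPotential.apply_iterate_next (hφ : B.IsPotential b φ) (hx : x.1 ∈ B.edges) (j : ℕ) :
    φ (B.next^[j] x) = φ x + ∑ t ∈ Finset.range j, if (B.next^[t] x).1 = b then 1 else 0 := by
  induction j with
  | zero => simp
  | succ j ih =>
    rw [Finset.sum_range_succ, ← add_assoc, ← ih, Function.iterate_succ_apply', next, hφ.arc,
      hφ.jump _ (B.iterate_next_mem hx j)]

theorem IsPotential.apply_end (hφ : B.IsPotential b φ) (hx : x.1 ∈ B.edges) (hxb : x.1 ≠ b) :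
    φ x = φ (x.1, x.2.1, false) := by
  obtain ⟨e, i, s⟩ := x
  cases s
  · rfl
  · exact (hφ.jump (e, i, false) hx).trans (by rw [if_neg hxb, add_zero])

theorem IsPotential.apply_ne_of_interlaced (hφ : B.IsPotential b φ) (ha : a ∈ B.edges)
    (hab : a ≠ b) (h : B.Interlaced a b) : φ (a, false, false) ≠ φ (a, true, false) := by
  obtain ⟨x, i, j, k, hi, hij, hjk, hk, hxa, hxi, hxj, hxk⟩ := h
  have hx : x.1 ∈ B.edges := hxa ▸ ha
  have honce : ∀ t ∈ Finset.range j, t ≠ i →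
      (if (B.next^[t] x).1 = b then (1 : ZMod 2) else 0) = 0 := by
    refine fun t ht hti => if_neg fun htb => ?_
    have htj := Finset.mem_range.1 ht
    have htk := B.eq_of_iterate_next_fst_eq hx (s := t) (t := i) (u := k) (by omega) (by omega) hk
      (htb.trans hxi.symm) (hxk.trans hxi.symm) hti (by omega)
    omega
  have hjump : φ (B.next^[j] x) = φ x + 1 := by
    rw [hφ.apply_iterate_next hx, Finset.sum_eq_single_of_mem i (Finset.mem_range.2 hij) honce,
      if_pos hxi]
  have hends : (B.next^[j] x).2.1 ≠ x.2.1 := fun h =>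
    (hi.trans hij).ne' (B.eq_of_iterate_next_end_eq hx (s := j) (t := 0) (by omega) (by omega)
      (hxj.trans hxa.symm) h)
  rw [hφ.apply_end (B.iterate_next_mem hx j) (hxj ▸ hab), hφ.apply_end hx (hxa ▸ hab), hxj, hxa,
    Bool.eq_not_of_ne hends] at hjump
  cases hi : x.2.1 <;> rw [hi] at hjump
  · exact (hjump.trans_ne (by simp)).symm
  · exact hjump.trans_ne (by simp)

theorem IsPotential.interlaced_of_apply_ne (hφ : B.IsPotential b φ) (ha : a ∈ B.edges)
    (hloop : B.IsLoop a) (hab : a ≠ b) (h : φ (a, false, false) ≠ φ (a, true, false)) :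
    B.Interlaced a b := by
  obtain ⟨j, -, hj, hja, hjt⟩ := hloop.exists_iterate_next ha
  let x : Corner α := (a, false, false)
  let crossing (t : ℕ) : ZMod 2 := if (B.next^[t] x).1 = b then 1 else 0
  have hfst : φ (a, true, false) = φ x + ∑ t ∈ Finset.range j, crossing t := by
    rw [← hφ.apply_iterate_next ha, hφ.apply_end (B.iterate_next_mem ha j) (by rwa [hja]), hja, hjt]
  have hsnd : φ x = φ (a, true, false) +
      ∑ t ∈ Finset.Ico j (Function.minimalPeriod B.next x), crossing t := by
    rw [hfst, add_assoc, Finset.sum_range_add_sum_Ico _ hj.le, ← hφ.apply_iterate_next ha,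
      Function.iterate_minimalPeriod]
  have crossing_eq {t : ℕ} (ht : crossing t ≠ 0) : (B.next^[t] x).1 = b :=
    of_not_not fun h => ht (if_neg h)
  obtain ⟨i, hi, hib⟩ := Finset.exists_ne_zero_of_sum_ne_zero fun h0 =>
    h (by rw [hfst, h0, add_zero])
  obtain ⟨k, hk, hkb⟩ := Finset.exists_ne_zero_of_sum_ne_zero fun h0 =>
    h (by rw [h0, add_zero] at hsnd; exact hsnd)
  rw [Finset.mem_range] at hi
  rw [Finset.mem_Ico] at hk
  refine ⟨x, i, j, k, Nat.pos_of_ne_zero ?_, hi, lt_of_le_of_ne hk.1 ?_, hk.2, rfl,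
    crossing_eq hib, hja, crossing_eq hkb⟩
  · rintro rfl
    exact hab (crossing_eq hib)
  · rintro rfl
    exact hab (hja.symm.trans (crossing_eq hkb))

theorem IsPotential.petrial (hφ : B.IsPotential b φ) (Y : Finset α) :
    (B.petrial Y).IsPotential b (φ ∘ Corner.swapOn Y) where
  arc x := by
    rw [Function.comp_apply, Function.comp_apply, arc_petrial, Corner.swapOn_swapOn, hφ.arc]
  jump x hx := by
    rw [Function.comp_apply, Function.comp_apply, Corner.swapOn_acrossEnd, hφ.jump _ (by
      rwa [Corner.swapOn_fst]), Corner.swapOn_fst]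

end Potential

section FaceVariation

variable {B : RibbonGraph α}

/-- The connected component on whose boundary a face lies. -/
def faceToComponent (B : RibbonGraph α) : B.Face → B.Component :=
  Sum.map (Quot.map id fun _ _ h => h.imp_right Or.inr) id

theorem faceToComponent_surjective : Function.Surjective B.faceToComponent := by
  rintro (⟨⟨x⟩⟩ | i)
  exacts [⟨Sum.inl (Quot.mk _ x), rfl⟩, ⟨Sum.inr i, rfl⟩]

/-- The value of a function of the faces at a corner lying on a face; `0` at the corners over labels
that are not edges. -/
def faceValue [DecidableEq α] (f : B.Face → ZMod 2) (x : Corner α) : ZMod 2 :=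
  if hx : x.1 ∈ B.edges then f (Sum.inl (Quot.mk _ ⟨x, hx⟩)) else 0

variable [DecidableEq α]

theorem faceValue_of_mem (f : B.Face → ZMod 2) {x : Corner α} (hx : x.1 ∈ B.edges) :
    faceValue f x = f (Sum.inl (Quot.mk _ ⟨x, hx⟩)) :=
  dif_pos hx

theorem faceValue_arc (f : B.Face → ZMod 2) {x : Corner α} (hx : x.1 ∈ B.edges) :
    faceValue f (B.arc x) = faceValue f x := by
  rw [faceValue_of_mem f hx, faceValue_of_mem f (B.arc_mem hx)]
  refine congrArg (f ∘ Sum.inl) (Quot.sound ?_).symm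
  exact Or.inl rfl

theorem faceValue_alongSide (f : B.Face → ZMod 2) {x : Corner α} (hx : x.1 ∈ B.edges) :
    faceValue f x.alongSide = faceValue f x := by
  rw [faceValue_of_mem f hx, faceValue_of_mem (x := x.alongSide) f hx]
  refine congrArg (f ∘ Sum.inl) (Quot.sound ?_).symm
  exact Or.inr rfl

theorem exists_faceValue_eq {h : Corner α → ZMod 2} (harc : ∀ x, h (B.arc x) = h x)
    (hside : ∀ x, x.1 ∈ B.edges → h x.alongSide = h x) :
    ∃ f : B.Face → ZMod 2, ∀ x, x.1 ∈ B.edges → faceValue f x = h x := by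
  refine ⟨Sum.elim (Quot.lift (fun x => h x.1) ?_) 0, fun x hx => faceValue_of_mem _ hx⟩
  rintro ⟨x, hx⟩ ⟨y, hy⟩ (hxy | hxy)
  exacts [((congrArg h hxy).trans (harc x)).symm, ((congrArg h hxy).trans (hside x hx)).symm]

/-- The coboundary of a function of the faces: its variation across every ribbon. -/
def faceVariation (B : RibbonGraph α) : (B.Face → ZMod 2) →ₗ[ZMod 2] (B.edges → ZMod 2) where
  toFun f e := faceValue f (e.1, false, false) + faceValue f (e.1, false, true)
  map_add' f g := by
    funext e
    simp only [faceValue_of_mem _ (x := (e.1, _, _)) e.2, Pi.add_apply]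
    ring
  map_smul' c f := by
    funext e
    simp only [faceValue_of_mem _ (x := (e.1, _, _)) e.2, Pi.smul_apply, smul_add, RingHom.id_apply]

theorem faceValue_acrossEnd (f : B.Face → ZMod 2) {x : Corner α} (hx : x.1 ∈ B.edges) :
    faceValue f x.acrossEnd = faceValue f x + B.faceVariation f ⟨x.1, hx⟩ := by
  obtain ⟨e, i, s⟩ := x
  have hside (i s) : faceValue f (e, i, s) = faceValue f (e, false, s) := by
    cases i
    exacts [rfl, faceValue_alongSide (x := (e, false, s)) f hx]
  change faceValue f (e, i, !s) =
    faceValue f (e, i, s) + (faceValue f (e, false, false) + faceValue f (e, false, true))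
  rw [hside i, hside i]
  cases s
  · exact (CharTwo.add_cancel_left _ _).symm
  · rw [add_comm (faceValue f (e, false, false))]
    exact (CharTwo.add_cancel_left _ _).symm

theorem ker_faceVariation : LinearMap.ker B.faceVariation =
    LinearMap.range (LinearMap.funLeft (ZMod 2) (ZMod 2) B.faceToComponent) := by
  ext f
  rw [LinearMap.mem_ker, LinearMap.mem_range]
  constructor
  · intro hf
    have hinv (x y : B.Corners)
        (h : y.1 = B.arc x.1 ∨ y.1 = x.1.acrossEnd ∨ y.1 = x.1.alongSide) :
        faceValue f x.1 = faceValue f y.1 := by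
      obtain h | h | h := h <;> rw [h]
      · rw [faceValue_arc f x.2]
      · rw [faceValue_acrossEnd f x.2, hf, Pi.zero_apply, add_zero]
      · rw [faceValue_alongSide f x.2]
    refine ⟨Sum.elim (Quot.lift (fun x => faceValue f x.1) hinv) (f ∘ Sum.inr), ?_⟩
    funext p
    obtain ⟨⟨x, hx⟩⟩ | i := p
    exacts [faceValue_of_mem f hx, rfl]
  · rintro ⟨g, rfl⟩
    funext e
    have hend : faceValue (g ∘ B.faceToComponent) (e.1, false, true) =
        faceValue (g ∘ B.faceToComponent) (e.1, false, false) := by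
      rw [faceValue_of_mem _ (x := (e.1, _, _)) e.2, faceValue_of_mem _ (x := (e.1, _, _)) e.2]
      refine congrArg (g ∘ Sum.inl) (Quot.sound ?_).symm
      exact Or.inr (Or.inl rfl)
    exact (congrArg (_ + ·) hend).trans (CharTwo.add_self_eq_zero _)

theorem finrank_ker_faceVariation :
    Module.finrank (ZMod 2) (LinearMap.ker B.faceVariation) = B.numComponents := by
  have := Fintype.ofFinite B.Component
  rw [ker_faceVariation, LinearMap.finrank_range_of_inj
    (LinearMap.funLeft_injective_of_surjective _ _ _ faceToComponent_surjective),
    Module.finrank_fintype_fun_eq_card, numComponents, Nat.card_eq_fintype_card]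

end FaceVariation

section PotentialMatrix

variable {B : RibbonGraph α} {φ : B.edges → Corner α → ZMod 2}

/-- The combination with coefficients `ψ` of functions `φ b` indexed by the edges. -/
def potentialSum (φ : B.edges → Corner α → ZMod 2) (ψ : B.edges → ZMod 2) (x : Corner α) : ZMod 2 :=
  ∑ b, ψ b * φ b x

/-- The matrix of variations of the potentials `φ b` between the two ends of the edges. -/
def potentialMatrix (B : RibbonGraph α) (φ : B.edges → Corner α → ZMod 2) :
    Matrix B.edges B.edges (ZMod 2) :=
  Matrix.of fun a b => φ b (a.1, false, false) + φ b (a.1, true, false)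

theorem potentialMatrix_mulVec (ψ : B.edges → ZMod 2) (a : B.edges) :
    (B.potentialMatrix φ).mulVec ψ a =
      potentialSum φ ψ (a.1, false, false) + potentialSum φ ψ (a.1, true, false) := by
  simp only [Matrix.mulVec, dotProduct, potentialMatrix, Matrix.of_apply, potentialSum,
    ← Finset.sum_add_distrib]
  exact Finset.sum_congr rfl fun b _ => by ring

variable [DecidableEq α]

theorem potentialSum_arc (hφ : ∀ b, B.IsPotential b.1 (φ b)) (ψ : B.edges → ZMod 2)
    (x : Corner α) : potentialSum φ ψ (B.arc x) = potentialSum φ ψ x :=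
  Finset.sum_congr rfl fun b _ => by rw [(hφ b).arc]

theorem potentialSum_acrossEnd (hφ : ∀ b, B.IsPotential b.1 (φ b)) (ψ : B.edges → ZMod 2)
    {x : Corner α} (hx : x.1 ∈ B.edges) :
    potentialSum φ ψ x.acrossEnd = potentialSum φ ψ x + ψ ⟨x.1, hx⟩ := by
  have hterm (b : B.edges) :
      ψ b * φ b x.acrossEnd = ψ b * φ b x + if ⟨x.1, hx⟩ = b then ψ b else 0 := by
    rw [(hφ b).jump x hx, mul_add, mul_ite, mul_one, mul_zero]
    simp only [Subtype.ext_iff]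
  simp only [potentialSum, hterm, Finset.sum_add_distrib, Finset.sum_ite_eq, Finset.mem_univ,
    if_true]

theorem potentialMatrix_mulVec_faceVariation (hφ : ∀ b, B.IsPotential b.1 (φ b))
    (hloop : ∀ b ∈ B.edges, B.IsLoop b) (f : B.Face → ZMod 2) :
    (B.potentialMatrix φ).mulVec (B.faceVariation f) = 0 := by
  funext a
  let g (x : Corner α) : ZMod 2 := faceValue f x + potentialSum φ (B.faceVariation f) x
  have hg : g (a.1, false, false) = g (a.1, true, false) := by
    refine apply_eq_of_cls_eq g (fun x hx => ?_) (fun x hx _ => ?_) (fun _ _ h => h.elim)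
      (hloop a.1 a.2)
    · simp only [g, faceValue_arc f hx, potentialSum_arc hφ]
    · simp only [g, faceValue_acrossEnd f hx, potentialSum_acrossEnd hφ _ hx]
      rw [add_add_add_comm, CharTwo.add_self_eq_zero, add_zero]
  have hside : faceValue f (a.1, true, false) = faceValue f (a.1, false, false) :=
    faceValue_alongSide (x := (a.1, false, false)) f a.2
  simp only [g, hside] at hg
  rw [potentialMatrix_mulVec, add_left_cancel hg]
  exact CharTwo.add_self_eq_zero _

theorem exists_faceVariation_eq (hφ : ∀ b, B.IsPotential b.1 (φ b)) {ψ : B.edges → ZMod 2}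
    (hψ : (B.potentialMatrix φ).mulVec ψ = 0) : ∃ f, B.faceVariation f = ψ := by
  have hends (a) (ha : a ∈ B.edges) :
      potentialSum φ ψ (a, true, false) = potentialSum φ ψ (a, false, false) := by
    have hzero := congrFun hψ ⟨a, ha⟩
    rw [potentialMatrix_mulVec] at hzero
    exact (CharTwo.add_eq_zero.1 hzero).symm
  have hcross (a i) (ha : a ∈ B.edges) :
      potentialSum φ ψ (a, i, true) = potentialSum φ ψ (a, i, false) + ψ ⟨a, ha⟩ :=
    potentialSum_acrossEnd hφ ψ (x := (a, i, false)) ha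
  have hside : ∀ x : Corner α, x.1 ∈ B.edges →
      potentialSum φ ψ x.alongSide = potentialSum φ ψ x := by
    rintro ⟨a, i, s⟩ ha
    change potentialSum φ ψ (a, !i, s) = potentialSum φ ψ (a, i, s)
    cases i <;> cases s <;>
      simp only [hcross a _ ha, hends a ha, Bool.not_false, Bool.not_true]
  obtain ⟨f, hf⟩ := exists_faceValue_eq (potentialSum_arc hφ ψ) hside
  refine ⟨f, funext fun a => ?_⟩
  change faceValue f (a.1, false, false) + faceValue f (a.1, false, true) = ψ a
  rw [hf _ a.2, hf (a.1, false, true) a.2, hcross a.1 false a.2]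
  exact CharTwo.add_cancel_left _ _

theorem range_faceVariation (hφ : ∀ b, B.IsPotential b.1 (φ b))
    (hloop : ∀ b ∈ B.edges, B.IsLoop b) :
    LinearMap.range B.faceVariation = LinearMap.ker (B.potentialMatrix φ).mulVecLin := by
  ext ψ
  rw [LinearMap.mem_range, LinearMap.mem_ker, Matrix.mulVecLin_apply]
  refine ⟨?_, exists_faceVariation_eq hφ⟩
  rintro ⟨f, rfl⟩
  exact potentialMatrix_mulVec_faceVariation hφ hloop f

theorem eulerGenus_eq_rank (hB : B.numVertices = B.numComponents)
    (hφ : ∀ b, B.IsPotential b.1 (φ b)) : B.eulerGenus = (B.potentialMatrix φ).rank := by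
  have := Fintype.ofFinite B.Face
  have hfaces := B.faceVariation.finrank_range_add_finrank_ker
  have hedges := (B.potentialMatrix φ).mulVecLin.finrank_range_add_finrank_ker
  rw [finrank_ker_faceVariation, range_faceVariation hφ fun _ => isLoop_of_numVertices_eq hB,
    Module.finrank_fintype_fun_eq_card, ← Nat.card_eq_fintype_card] at hfaces
  rw [Module.finrank_fintype_fun_eq_card, Fintype.card_coe] at hedges
  rw [eulerGenus, eulerChar, hB, numFaces, Matrix.rank]
  omega

theorem potentialMatrix_petrial (hφ : ∀ b, B.IsPotential b.1 (φ b)) (Y : Finset α) :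
    (B.petrial Y).potentialMatrix (fun b => φ b ∘ Corner.swapOn Y) =
      B.potentialMatrix φ + B.diagOf Y := by
  refine Matrix.ext (m := B.edges) (n := B.edges) fun a b => ?_
  have hfst : Corner.swapOn Y (a.1, false, false) = (a.1, false, false) :=
    if_neg fun h => Bool.false_ne_true h.2
  have hsnd : φ b (Corner.swapOn Y (a.1, true, false)) = φ b (a.1, true, false) +
      B.diagOf Y a b := by
    rw [diagOf, Matrix.diagonal_apply]
    by_cases haY : a.1 ∈ Y
    · rw [Corner.swapOn, if_pos ⟨haY, rfl⟩, (hφ b).jump _ a.2, if_pos haY]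
      simp only [Subtype.ext_iff]
    · rw [Corner.swapOn_of_notMem haY, if_neg haY, ite_self, add_zero]
  change φ b (Corner.swapOn Y (a.1, false, false)) + φ b (Corner.swapOn Y (a.1, true, false)) =
    φ b (a.1, false, false) + φ b (a.1, true, false) + B.diagOf Y a b
  rw [hfst, hsnd, add_assoc]

theorem potentialMatrix_apply_of_ne (hφ : ∀ b, B.IsPotential b.1 (φ b))
    (hloop : ∀ b ∈ B.edges, B.IsLoop b) {a b : B.edges} (hab : a ≠ b) :
    B.potentialMatrix φ a b = B.adjI a b := by
  have hab' : a.1 ≠ b.1 := fun h => hab (Subtype.ext h)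
  classical
  have hadj : B.intersectionGraph.Adj a b ↔ φ b (a.1, false, false) ≠ φ b (a.1, true, false) := by
    rw [intersectionGraph, SimpleGraph.fromRel_adj]
    constructor
    · exact fun h => (hφ b).apply_ne_of_interlaced a.2 hab' (h.2.elim id Interlaced.symm)
    · exact fun h => ⟨hab, Or.inl ((hφ b).interlaced_of_apply_ne a.2 (hloop a.1 a.2) hab' h)⟩
  have hsum : ∀ u v : ZMod 2, u + v = if u ≠ v then 1 else 0 := by decide
  rw [adjI, SimpleGraph.adjMatrix_apply, potentialMatrix, Matrix.of_apply, hsum]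
  exact if_congr hadj.symm rfl rfl

theorem exists_potentialMatrix_eq (hφ : ∀ b, B.IsPotential b.1 (φ b))
    (hloop : ∀ b ∈ B.edges, B.IsLoop b) :
    ∃ S ⊆ B.edges, B.potentialMatrix φ = B.adjI + B.diagOf S := by
  let twisted : Finset B.edges := {a | B.potentialMatrix φ a a = 1}
  refine ⟨twisted.map (Function.Embedding.subtype _), fun a ha => ?_, ?_⟩
  · obtain ⟨b, -, rfl⟩ := Finset.mem_map.1 ha
    exact b.2
  · ext a b
    rw [Matrix.add_apply, diagOf]
    by_cases hab : a = b
    · subst hab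
      have hbit : ∀ u : ZMod 2, u = if u = 1 then 1 else 0 := by decide
      rw [adjI, SimpleGraph.adjMatrix_apply, if_neg (SimpleGraph.irrefl _), zero_add,
        Matrix.diagonal_apply_eq]
      simpa [twisted] using hbit (B.potentialMatrix φ a a)
    · rw [Matrix.diagonal_apply_ne _ hab, add_zero, potentialMatrix_apply_of_ne hφ hloop hab]

theorem diagOf_add_diagOf (B : RibbonGraph α) (S Y : Finset α) :
    B.diagOf S + B.diagOf Y = B.diagOf (symmDiff S Y) := by
  rw [diagOf, diagOf, diagOf, Matrix.diagonal_add]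
  congr 1
  funext e
  by_cases hS : e.1 ∈ S <;> by_cases hY : e.1 ∈ Y <;>
    simp [Finset.mem_symmDiff, hS, hY, CharTwo.add_self_eq_zero]

theorem exists_eulerGenus_petrial_eq_rank (hB : B.numVertices = B.numComponents) :
    ∃ S ⊆ B.edges, ∀ Y,
      (B.petrial Y).eulerGenus = (B.adjI + B.diagOf (symmDiff S Y)).rank := by
  have hloop : ∀ b ∈ B.edges, B.IsLoop b := fun _ => isLoop_of_numVertices_eq hB
  choose φ hφ using fun b : B.edges => (hloop b b.2).exists_isPotential b.2
  obtain ⟨S, hS, hM⟩ := exists_potentialMatrix_eq hφ hloop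
  refine ⟨S, hS, fun Y => ?_⟩
  have hBY : (B.petrial Y).numVertices = (B.petrial Y).numComponents := by
    rw [numVertices_petrial, numComponents_petrial, hB]
  rw [eulerGenus_eq_rank hBY fun b => (hφ b).petrial Y, potentialMatrix_petrial hφ, hM, add_assoc,
    diagOf_add_diagOf]
  rfl

theorem petrialPoly_eq_sum_rank (hB : B.numVertices = B.numComponents) :
    B.petrialPoly = ∑ Y ∈ B.edges.powerset, Polynomial.X ^ (B.adjI + B.diagOf Y).rank := by
  obtain ⟨S, hS, hgenus⟩ := exists_eulerGenus_petrial_eq_rank hB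
  have hmaps : ∀ Y ∈ B.edges.powerset, symmDiff S Y ∈ B.edges.powerset := fun Y hY =>
    Finset.mem_powerset.2
      (symmDiff_le_sup.trans (Finset.union_subset hS (Finset.mem_powerset.1 hY)))
  exact Finset.sum_nbij' (symmDiff S) (symmDiff S) hmaps hmaps
    (fun Y _ => symmDiff_symmDiff_cancel_left S Y) (fun Y _ => symmDiff_symmDiff_cancel_left S Y)
    fun Y _ => by rw [hgenus, Int.toNat_natCast]

end PotentialMatrix

end RibbonGraph

theorem theorem2_general {α : Type*} [DecidableEq α] (G : RibbonGraph α) (l : List α)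
    (hl : l.Nodup) (hT : G.IsSpanningForest l.toFinset) :
    l.toFinset.powerset.card = 2 ^ (G.numVertices - G.numComponents) ∧
    (∀ X ∈ l.toFinset.powerset, ((G.petrial X).aux l).numVertices = G.numComponents ∧
      ((G.petrial X).aux l).numComponents = G.numComponents ∧
      ((G.petrial X).aux l).edges = G.edges \ l.toFinset) ∧
    G.petrialPoly = ∑ X ∈ l.toFinset.powerset, ((G.petrial X).aux l).petrialPoly ∧
    G.petrialPoly = ∑ X ∈ l.toFinset.powerset, ∑ Y ∈ (G.edges \ l.toFinset).powerset,
      Polynomial.X ^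
        (((G.petrial X).aux l).adjI + ((G.petrial X).aux l).diagOf Y).rank := by
  have hV (X) : ((G.petrial X).aux l).numVertices = G.numComponents :=
    ((hT.petrial X).numVertices_aux hl).trans (G.numComponents_petrial X)
  have hC (X) : ((G.petrial X).aux l).numComponents = G.numComponents :=
    ((hT.petrial X).numComponents_aux hl).trans (G.numComponents_petrial X)
  have hE (X) : ((G.petrial X).aux l).edges = G.edges \ l.toFinset := (G.petrial X).edges_aux l
  have hsum := hT.petrialPoly_eq_sum_aux hl
  refine ⟨by rw [Finset.card_powerset, hT.card_eq], fun X _ => ⟨hV X, hC X, hE X⟩, hsum, ?_⟩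
  refine hsum.trans (Finset.sum_congr rfl fun X _ => ?_)
  rw [RibbonGraph.petrialPoly_eq_sum_rank ((hV X).trans (hC X).symm)]
  exact Finset.sum_congr (congrArg Finset.powerset (hE X)) fun _ _ => rfl

theorem theorem2 {α : Type*} [DecidableEq α] (G : RibbonGraph α) (hG : G.Connected)
    (hn : 2 ≤ G.numVertices) (T : Finset α) (hT : G.IsSpanningTree T)
    (l : List α) (hl : l.Nodup) (hlT : l.toFinset = T) :
    T.powerset.card = 2 ^ (G.numVertices - 1) ∧
    (∀ X ∈ T.powerset, ((G.petrial X).aux l).IsBouquet ∧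
      ((G.petrial X).aux l).edges = G.edges \ T) ∧
    G.petrialPoly = ∑ X ∈ T.powerset, ((G.petrial X).aux l).petrialPoly ∧
    G.petrialPoly = ∑ X ∈ T.powerset, ∑ Y ∈ (G.edges \ T).powerset,
      Polynomial.X ^
        (((G.petrial X).aux l).adjI + ((G.petrial X).aux l).diagOf Y).rank := by
  subst hlT
  obtain ⟨hcard, haux, hpoly⟩ := theorem2_general G l hl (hT.isSpanningForest hG)
  exact ⟨hG ▸ hcard, fun X hX => ⟨(haux X hX).1.trans hG, (haux X hX).2.2⟩, hpoly⟩
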